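/- **Setting.** Let $(X,d,\mu)$ be a complete metric space with a doubling Borel regular measure $\mu$, i.e. $0<\mu(B(y,2r))\le C_d\,\mu(B(y,r))<\infty$ for all $y\in X$, $r>0$. Let $1<p<q<\infty$ and suppose that $X$ supports a weak $(1,p)$-Poincaré inequality: there are $C>0$, $\lambda\ge1$ such that $$\frac1{\mu(B(y,r))}\int_{B(y,r)}|u-u_{B(y,r)}|\,d\mu\le C r\Big(\frac1{\mu(B(y,\lambda r))}\int_{B(y,\lambda r)}g^p\,d\mu\Big)^{1/p}$$ for all balls $B(y,r)$, all $u:X\to\mathbb R$ that are integrable on balls, and all upper gradients $g$ of $u$; here $u_{B}$ is the mean value of $u$ over $B$. Let $\Omega\subset X$ be a nonempty open set with $\mu(X\setminus\Omega)>0$, and let $a,b:X\to\mathbb R$ be measurable with $\alpha\le a,b\le\beta$ for some constants $0<\alpha\le\beta$. **Definitions.** Let $U=\Omega$ or $U=X$, viewed as a metric measure space with the restrictions of $d$ and $\mu$. A Borel function $g:U\to[0,\infty]$ is an upper gradient of $u:U\to[-\infty,\infty]$ if for every nonconstant compact rectifiable curve $\gamma$ in $U$ with end points $x,y$ we have $|u(x)-u(y)|\le\int_\gamma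 g\,ds$ when $u(x),u(y)$ are both finite, and $\int_\gamma g\,ds=\infty$ otherwise. It is a $q$-weak upper gradient if this holds for all such curves outside a family $\Gamma$ of $q$-modulus zero, where the $q$-modulus of $\Gamma$ is $\inf_\rho\int_U\rho^q\,d\mu$ over all Borel $\rho\ge0$ with $\int_\gamma\rho\,ds\ge1$ for every $\gamma\in\Gamma$. $N^{1,q}(U)$ is the set of measurable functions $u:U\to[-\infty,\infty]$ with $\int_U|u|^q\,d\mu<\infty$ that have a $q$-weak upper gradient in $L^q(U)$; such a $u$ has an a.e. smallest $q$-weak upper gradient in $L^q(U)$, the minimal $q$-weak upper gradient $g_u$. $N^{1,q}_0(\Omega)$ is the set of functions on $\Omega$ whose extension by zero belongs to $N^{1,q}(X)$. The capacity of $E\subset X$ is $C_q(E)=\inf_u\big(\int_X|u|^q\,d\mu+\int_X g_u^q\,d\mu\big)$ over all $u\in N^{1,q}(X)$ with $u=1$ on $E$. A function $u\in N^{1,q}(\Omega)$ is a $(p,q)$-minimizer on $\Omega$ if $$J(u)\le J(v),\qquad J(w):=\int_\Omega a\,g_w^p\,d\mu+\int_\Omega b\,g_w^q\,d\mu\in[0,\infty],$$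 for all $v\in N^{1,q}(\Omega)$ with $u-v\in N^{1,q}_0(\Omega)$. **Theorem (uniqueness of $(p,q)$-minimizers).** Let $u_1,u_2$ be $(p,q)$-minimizers on $\Omega$ with $u_1-u_2\in N^{1,q}_0(\Omega)$. Assume that $\Omega$ is bounded or, more generally, that $J(u_1)<\infty$ (which is automatic if $\Omega$ is bounded). Then 1. $g_{u_1}=g_{u_2}$ $\mu$-a.e. in $\Omega$; 2. $u_1=u_2$ $\mu$-a.e. in $\Omega$; 3. $u_1=u_2$ $q$-quasieverywhere in $\Omega$, i.e. $C_q(\{x\in\Omega:u_1(x)\ne u_2(x)\})=0$. -/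

import Mathlib

open MeasureTheory Set Metric
open scoped ENNReal NNReal

namespace Newtonian

/-- A nonconstant compact rectifiable curve in `X`, parametrized by arc length on
`[0, length]`.  The values of `toFun` outside `[0, length]` are never used. -/
structure RectCurve (X : Type*) [MetricSpace X] where
  toFun : ℝ → X
  length : ℝ
  length_pos : 0 < length
  unitSpeed : HasUnitSpeedOn toFun (Icc 0 length)

section Basic

variable {X : Type*} [MetricSpace X]

/-- The curve `γ` lies in `U`. -/
def RectCurve.LiesIn (γ : RectCurve X) (U : Set X) : Prop :=
  ∀ t ∈ Icc (0 : ℝ) γ.length, γ.toFun t ∈ U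

/-- The line integral `∫_γ g ds`. -/
noncomputable def RectCurve.lineIntegral (γ : RectCurve X) (g : X → ℝ≥0∞) : ℝ≥0∞ :=
  ∫⁻ t in Icc (0 : ℝ) γ.length, g (γ.toFun t)

/-- The upper gradient inequality `|u(x) - u(y)| ≤ ∫_γ g ds` for the end points `x, y` of `γ`.
In `EReal` the difference of two values is infinite as soon as one of them is infinite
(`⊤ - ⊤ = ⊥ - ⊥ = ⊥`), and `EReal.abs` takes values in `[0, ∞]`; hence the inequality says
`∫_γ g ds = ∞` unless both `u(x)` and `u(y)` are finite. -/
def UpperGradientIneq (u : X → EReal) (g : X → ℝ≥0∞) (γ : RectCurve X) : Prop :=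
  (u (γ.toFun 0) - u (γ.toFun γ.length)).abs ≤ γ.lineIntegral g

variable [MeasurableSpace X]

/-- `g` is an upper gradient of `u` in `U`, where `U` is regarded as a metric space in its own
right (the curves of `U` are the curves of `X` that lie in `U`). -/
def IsUpperGradient (U : Set X) (u : X → EReal) (g : X → ℝ≥0∞) : Prop :=
  Measurable g ∧ ∀ γ : RectCurve X, γ.LiesIn U → UpperGradientIneq u g γ

/-- The `q`-modulus of a family of curves. -/
noncomputable def modulus (μ : Measure X) (q : ℝ) (Γ : Set (RectCurve X)) : ℝ≥0∞ :=
  ⨅ (ρ : X → ℝ≥0∞) (_ : Measurable ρ) (_ : ∀ γ ∈ Γ, 1 ≤ γ.lineIntegral ρ), ∫⁻ x, ρ x ^ q ∂μ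

/-- `g` is a `q`-weak upper gradient of `u` in `U` (with the restricted metric and measure): the
upper gradient inequality holds for all curves in `U` outside a family of `q`-modulus zero. -/
def IsWeakUpperGradient (μ : Measure X) (q : ℝ) (U : Set X) (u : X → EReal)
    (g : X → ℝ≥0∞) : Prop :=
  Measurable g ∧
    modulus (μ.restrict U) q {γ | γ.LiesIn U ∧ ¬ UpperGradientIneq u g γ} = 0

/-- `g` is a minimal `q`-weak upper gradient of `u` in `U`: it belongs to `L^q(U)` and is a.e. the
smallest among the `q`-weak upper gradients of `u` in `L^q(U)`. -/
def IsMinimalWeakUpperGradient (μ : Measure X) (q : ℝ) (U : Set X) (u : X → EReal)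
    (g : X → ℝ≥0∞) : Prop :=
  IsWeakUpperGradient μ q U u g ∧ ∫⁻ x in U, g x ^ q ∂μ < ⊤ ∧
    ∀ h : X → ℝ≥0∞, IsWeakUpperGradient μ q U u h → ∫⁻ x in U, h x ^ q ∂μ < ⊤ →
      ∀ᵐ x ∂(μ.restrict U), g x ≤ h x

open Classical in
/-- The minimal `q`-weak upper gradient `g_u` of `u` in `U`.  It is determined up to sets of
measure zero, and exists whenever `u ∈ N^{1,q}(U)`; if there is none, we put `g_u = ∞`. -/
noncomputable def minGrad (μ : Measure X) (q : ℝ) (U : Set X) (u : X → EReal) : X → ℝ≥0∞ :=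
  if h : ∃ g, IsMinimalWeakUpperGradient μ q U u g then h.choose else fun _ => ⊤

/-- `u ∈ N^{1,q}(U)`: `u` is measurable on `U`, `u ∈ L^q(U)`, and `u` has a `q`-weak upper gradient
in `L^q(U)` (equivalently, `g_u ∈ L^q(U)`).  Only the values of `u` on `U` matter, and `u` is a
function defined everywhere on `U`, not an equivalence class. -/
def MemNewtonian (μ : Measure X) (q : ℝ) (U : Set X) (u : X → EReal) : Prop :=
  AEMeasurable u (μ.restrict U) ∧
  ∫⁻ x in U, (u x).abs ^ q ∂μ < ⊤ ∧
  ∃ g : X → ℝ≥0∞, IsWeakUpperGradient μ q U u g ∧ ∫⁻ x in U, g x ^ q ∂μ < ⊤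

/-- `u ∈ N^{1,q}_0(U)`: the extension of `u` from `U` by zero belongs to `N^{1,q}(X)`. -/
def MemNewtonianZero (μ : Measure X) (q : ℝ) (U : Set X) (u : X → EReal) : Prop :=
  MemNewtonian μ q univ (U.indicator u)

/-- The Sobolev capacity `C_q(E)`. -/
noncomputable def capacity (μ : Measure X) (q : ℝ) (E : Set X) : ℝ≥0∞ :=
  ⨅ (u : X → EReal) (_ : MemNewtonian μ q univ u) (_ : ∀ x ∈ E, u x = 1),
    (∫⁻ x, (u x).abs ^ q ∂μ + ∫⁻ x, minGrad μ q univ u x ^ q ∂μ)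

/-- The measure `μ` is doubling (on open balls). -/
def IsDoubling (μ : Measure X) : Prop :=
  ∃ C : ℝ≥0, 1 ≤ C ∧ ∀ (y : X) (r : ℝ), 0 < r →
    0 < μ (ball y (2 * r)) ∧ μ (ball y (2 * r)) ≤ C * μ (ball y r) ∧ μ (ball y r) < ⊤

/-- `X` supports a weak `(1, s)`-Poincaré inequality: for all functions `u` that are integrable on
balls and all upper gradients `g` of `u` in `X`. -/
def SupportsPoincare (μ : Measure X) (s : ℝ) : Prop :=
  ∃ (C : ℝ) (l : ℝ), 0 < C ∧ 1 ≤ l ∧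
    ∀ u : X → ℝ, (∀ (z : X) (R : ℝ), IntegrableOn u (ball z R) μ) →
    ∀ g : X → ℝ≥0∞, IsUpperGradient univ (fun x => (u x : EReal)) g →
    ∀ (y : X) (r : ℝ), 0 < r →
      ⨍⁻ x in ball y r, ENNReal.ofReal |u x - ⨍ z in ball y r, u z ∂μ| ∂μ ≤
        ENNReal.ofReal (C * r) * (⨍⁻ x in ball y (l * r), g x ^ s ∂μ) ^ (1 / s)

/-- The `(p,q)`-Dirichlet integral `∫_U a g_u^p dμ + ∫_U b g_u^q dμ`, where `g_u` is the minimal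
`q`-weak upper gradient of `u` in `U`. -/
noncomputable def energy (μ : Measure X) (p q : ℝ) (a b : X → ℝ) (U : Set X)
    (u : X → EReal) : ℝ≥0∞ :=
  ∫⁻ x in U, ENNReal.ofReal (a x) * minGrad μ q U u x ^ p ∂μ +
    ∫⁻ x in U, ENNReal.ofReal (b x) * minGrad μ q U u x ^ q ∂μ

/-- `u` is a (global) `(p,q)`-minimizer on `U`: `u ∈ N^{1,q}(U)` has the least energy among all
`v ∈ N^{1,q}(U)` with `u - v ∈ N^{1,q}_0(U)`. -/
def IsMinimizer (μ : Measure X) (p q : ℝ) (a b : X → ℝ) (U : Set X) (u : X → EReal) : Prop :=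
  MemNewtonian μ q U u ∧
    ∀ v : X → EReal, MemNewtonian μ q U v → MemNewtonianZero μ q U (fun x => u x - v x) →
      energy μ p q a b U u ≤ energy μ p q a b U v

end Basic

end Newtonian

/-! ### Absolutely continuous functions of one variable -/

namespace AbsolutelyContinuousOnInterval

/-! The energy is convex in the gradient, and strictly so through its `q`-term because `b > 0`. The
midpoint of two minimizers is a competitor whose minimal gradient is at most the mean of theirs.
Since the energy is finite, equality must hold in the convexity inequality almost everywhere, so the
two gradients agree (`ae_eq_of_energy_midpoint_le`).

Strict convexity in the gradient says nothing yet about the functions. For rational `c` the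
competitor `max u₁ (min u₂ c)` is constant on `{u₁ < c < u₂}` and elsewhere has gradient at most
`max g₁ g₂ = g₁`. Minimality of `u₁` forces `g₁ = 0` on that set
(`ae_eq_zero_of_energy_indicator_compl_le`). Taking the union over `c` and exchanging the roles,
both gradients vanish a.e. on `{u₁ ≠ u₂}`.

Hence the zero extension of `u₁ - u₂` has `0` as a weak upper gradient
(`isWeakUpperGradient_zero_of_ae_eq_zero`). By the Poincaré inequality it is a.e. constant on balls,
and it is zero on the complement of `Ω`, which has positive measure, so it vanishes a.e. Finally, a
Newtonian function that vanishes a.e. vanishes along almost every curve, which upgrades this to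
quasieverywhere (`capacity_eq_zero_of_ae_eq_zero`).

All gradient estimates are reduced to one variable: along almost every curve a Newtonian function is
absolutely continuous with derivative bounded by its weak upper gradient (`AbsContAlong`). -/

theorem of_dist_le_add {f k h : ℝ → ℝ} {a b : ℝ} (hf : AbsolutelyContinuousOnInterval f a b)
    (hk : AbsolutelyContinuousOnInterval k a b)
    (H : ∀ s ∈ uIcc a b, ∀ t ∈ uIcc a b, dist (h s) (h t) ≤ dist (f s) (f t) + dist (k s) (k t)) :
    AbsolutelyContinuousOnInterval h a b := by
  have hsum := Filter.Tendsto.add hf hk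
  rw [add_zero] at hsum
  refine squeeze_zero' (Filter.Eventually.of_forall
    fun E => Finset.sum_nonneg fun _ _ => dist_nonneg) ?_ hsum
  refine Filter.eventually_inf_principal.mpr (Filter.Eventually.of_forall fun E hE => ?_)
  rw [← Finset.sum_add_distrib]
  exact Finset.sum_le_sum fun i hi => H _ (hE.1 i hi).1 _ (hE.1 i hi).2

theorem const (c : ℝ) (a b : ℝ) : AbsolutelyContinuousOnInterval (fun _ => c) a b := by
  simpa [AbsolutelyContinuousOnInterval] using tendsto_const_nhds

theorem max {f k : ℝ → ℝ} {a b : ℝ} (hf : AbsolutelyContinuousOnInterval f a b)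
    (hk : AbsolutelyContinuousOnInterval k a b) :
    AbsolutelyContinuousOnInterval (fun t => Max.max (f t) (k t)) a b := by
  refine of_dist_le_add hf hk fun s _ t _ => ?_
  simp only [Real.dist_eq]
  refine (abs_max_sub_max_le_max _ _ _ _).trans (max_le ?_ ?_)
  · linarith [abs_nonneg (k s - k t)]
  · linarith [abs_nonneg (f s - f t)]

theorem min {f k : ℝ → ℝ} {a b : ℝ} (hf : AbsolutelyContinuousOnInterval f a b)
    (hk : AbsolutelyContinuousOnInterval k a b) :
    AbsolutelyContinuousOnInterval (fun t => Min.min (f t) (k t)) a b := by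
  refine of_dist_le_add hf hk fun s _ t _ => ?_
  simp only [Real.dist_eq]
  refine (abs_min_sub_min_le_max _ _ _ _).trans (max_le ?_ ?_)
  · linarith [abs_nonneg (k s - k t)]
  · linarith [abs_nonneg (f s - f t)]

theorem enorm_sub_le_lintegral_enorm_deriv {f : ℝ → ℝ} {a b : ℝ} (hab : a ≤ b)
    (hf : AbsolutelyContinuousOnInterval f a b) :
    ‖f a - f b‖ₑ ≤ ∫⁻ t in Icc a b, ‖deriv f t‖ₑ := by
  rw [← neg_sub, enorm_neg, ← hf.integral_deriv_eq_sub, intervalIntegral.integral_of_le hab]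
  exact (enorm_integral_le_lintegral_enorm _).trans (lintegral_mono_set Ioc_subset_Icc_self)

end AbsolutelyContinuousOnInterval

/-! ### Almost everywhere comparison of derivatives on the line. -/

theorem abs_deriv_le_of_dist_le {f F : ℝ → ℝ} {f' F' t : ℝ} (hf : HasDerivAt f f' t)
    (hF : HasDerivAt F F' t) (h : ∀ᶠ s in nhds t, |f s - f t| ≤ |F s - F t|) : |f'| ≤ |F'| := by
  rw [hasDerivAt_iff_tendsto_slope] at hf hF
  refine le_of_tendsto_of_tendsto hf.abs hF.abs ?_
  filter_upwards [nhdsWithin_le_nhds h] with s hs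
  simp only [slope_def_field, abs_div]
  gcongr

/-- Only countably many points of `{f = k}` are isolated from the right within this set. At any
other point of it the set accumulates, so the derivative is determined by values on the set. This is
the source of every "gradient vanishes on level sets" argument below. -/
theorem ae_deriv_eq_of_eq (f k : ℝ → ℝ) :
    ∀ᵐ t, f t = k t → DifferentiableAt ℝ f t → DifferentiableAt ℝ k t → deriv f t = deriv k t := by
  have hc := (countable_setOfPred_isolated_right_within (s := {t | f t = k t})).ae_notMem volume
  filter_upwards [hc] with t ht hfk hf hk
  have hne : nhdsWithin t ({t | f t = k t} ∩ Ioi t) ≠ ⊥ := fun h => ht ⟨hfk, h⟩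
  have hu : UniqueDiffWithinAt ℝ ({t | f t = k t} ∩ Ioi t) t := by
    rw [uniqueDiffWithinAt_iff_accPt, accPt_principal_iff_nhdsWithin,
      sdiff_singleton_eq_self (by simp)]
    exact ⟨hne⟩
  have h1 := hf.hasDerivAt.hasDerivWithinAt (s := {t | f t = k t} ∩ Ioi t)
  have h2 := hk.hasDerivAt.hasDerivWithinAt (s := {t | f t = k t} ∩ Ioi t)
  exact hu.eq_deriv _ h1 (h2.congr (fun x hx => hx.1) hfk)

/-- The increments of `f` are dominated by those of the primitive `F` of `G`. This transfers
absolute continuity, and Lebesgue differentiation of `F` bounds the derivative. -/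
theorem absolutelyContinuousOnInterval_of_le_lintegral {f : ℝ → ℝ} {G : ℝ → ℝ≥0∞} {a b : ℝ}
    (hab : a ≤ b) (hG : AEMeasurable G (volume.restrict (Icc a b)))
    (hfin : ∫⁻ t in Icc a b, G t ≠ ⊤)
    (H : ∀ s t, a ≤ s → s < t → t ≤ b → ‖f s - f t‖ₑ ≤ ∫⁻ x in Icc s t, G x) :
    AbsolutelyContinuousOnInterval f a b ∧ ∀ᵐ t, t ∈ Icc a b → ‖deriv f t‖ₑ ≤ G t := by
  set g : ℝ → ℝ := fun t => (G t).toReal with hg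
  have hgi : IntegrableOn g (Icc a b) := integrable_toReal_of_lintegral_ne_top hG hfin
  have hgI : IntervalIntegrable g volume a b := by
    rw [intervalIntegrable_iff_integrableOn_Icc_of_le hab]
    exact hgi
  have hlt : ∀ᵐ t ∂volume.restrict (Icc a b), G t < ⊤ := ae_lt_top' hG hfin
  set F : ℝ → ℝ := fun x => ∫ v in a..x, g v with hF
  have hFac : AbsolutelyContinuousOnInterval F a b :=
    hgI.absolutelyContinuousOnInterval_intervalIntegral left_mem_uIcc
  have key : ∀ s t, a ≤ s → s < t → t ≤ b → |f s - f t| ≤ |F s - F t| := by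
    intro s t hs hst ht
    have hsub : Icc s t ⊆ Icc a b := Icc_subset_Icc hs ht
    have h1 : F t - F s = ∫ v in s..t, g v :=
      intervalIntegral.integral_interval_sub_left
        (hgI.mono_set (by rw [uIcc_of_le hab, uIcc_of_le (hs.trans hst.le)]
                          exact Icc_subset_Icc le_rfl ht))
        (hgI.mono_set (by rw [uIcc_of_le hab, uIcc_of_le hs]
                          exact Icc_subset_Icc le_rfl (hst.le.trans ht)))
    have h2 : F t - F s = (∫⁻ x in Icc s t, G x).toReal := by
      rw [h1, intervalIntegral.integral_of_le hst.le, ← integral_Icc_eq_integral_Ioc]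
      exact integral_toReal (hG.mono_measure (Measure.restrict_mono hsub le_rfl))
        (ae_restrict_of_ae_restrict_of_subset hsub hlt)
    have h3 : ∫⁻ x in Icc s t, G x ≠ ⊤ := ne_top_of_le_ne_top hfin (lintegral_mono_set hsub)
    have h4 := ENNReal.toReal_mono h3 (H s t hs hst ht)
    rw [toReal_enorm, Real.norm_eq_abs, ← h2] at h4
    rw [abs_sub_comm (F s)]
    exact h4.trans (le_abs_self _)
  have key' : ∀ s ∈ Icc a b, ∀ t ∈ Icc a b, |f s - f t| ≤ |F s - F t| := by
    intro s hs t ht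
    rcases lt_trichotomy s t with h | h | h
    · exact key s t hs.1 h ht.2
    · simp [h]
    · rw [abs_sub_comm, abs_sub_comm (F s)]
      exact key t s ht.1 h hs.2
  have hac : AbsolutelyContinuousOnInterval f a b := by
    refine .of_dist_le_add hFac hFac fun s hs t ht => ?_
    rw [uIcc_of_le hab] at hs ht
    simp only [Real.dist_eq]
    linarith [key' s hs t ht, abs_nonneg (F s - F t)]
  refine ⟨hac, ?_⟩
  rw [ae_restrict_iff' measurableSet_Icc] at hlt
  filter_upwards [hac.ae_differentiableAt, hgI.ae_hasDerivAt_integral, hlt,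
    Measure.ae_ne volume a, Measure.ae_ne volume b] with t h1 h2 h3 hta htb ht
  have ht' : t ∈ uIcc a b := by rwa [uIcc_of_le hab]
  have hd := h2 ht' a left_mem_uIcc
  have hnear : ∀ᶠ s in nhds t, |f s - f t| ≤ |F s - F t| := by
    have : t ∈ Ioo a b := ⟨lt_of_le_of_ne ht.1 hta.symm, lt_of_le_of_ne ht.2 htb⟩
    filter_upwards [Ioo_mem_nhds this.1 this.2] with s hs
    exact key' s (Ioo_subset_Icc_self hs) t ht
  have := abs_deriv_le_of_dist_le (h1 ht').hasDerivAt hd hnear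
  rw [abs_of_nonneg ENNReal.toReal_nonneg] at this
  rw [← ofReal_norm, Real.norm_eq_abs]
  exact (ENNReal.ofReal_le_ofReal this).trans ENNReal.ofReal_toReal_le

namespace Newtonian

/-! ### Auxiliary facts on Lebesgue integrals -/

theorem exists_pos_forall_tsum_mul_lt_top (I : ℕ → ℝ≥0∞) (hI : ∀ n, I n < ⊤) :
    ∃ c : ℕ → ℝ≥0∞, (∀ n, c n ≠ 0) ∧ (∀ n, c n ≠ ⊤) ∧ ∑' n, c n * I n < ⊤ := by
  obtain ⟨δ, hδ, hsum⟩ := ENNReal.exists_pos_sum_of_countable' (ε := 1) one_ne_zero ℕ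
  refine ⟨fun n => min 1 (δ n / (I n + 1)), fun n => ?_, fun n => ?_, ?_⟩
  · refine (lt_min one_pos (ENNReal.div_pos (hδ n).ne' ?_)).ne'
    exact (ENNReal.add_lt_top.2 ⟨hI n, ENNReal.one_lt_top⟩).ne
  · exact ((min_le_left _ _).trans_lt ENNReal.one_lt_top).ne
  · refine lt_of_le_of_lt (ENNReal.tsum_le_tsum fun n => ?_) (hsum.trans ENNReal.one_lt_top)
    calc min 1 (δ n / (I n + 1)) * I n ≤ δ n / (I n + 1) * (I n + 1) := by
          gcongr
          · exact min_le_right _ _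
          · exact le_self_add
      _ ≤ δ n := (ENNReal.mul_div_le.trans' (mul_comm _ _).le)

/-- Combining densities by a supremum instead of a sum avoids Minkowski's inequality: a power of a
supremum is at most the sum of the powers. -/
theorem lintegral_iSup_mul_rpow_le {α : Type*} [MeasurableSpace α] (μ : Measure α) {q : ℝ}
    (hq : 0 < q) (ε : ℕ → ℝ≥0∞)
    (ρ : ℕ → α → ℝ≥0∞) (hρ : ∀ n, Measurable (ρ n)) :
    ∫⁻ x, (⨆ n, ε n * ρ n x) ^ q ∂μ ≤ ∑' n, ε n ^ q * ∫⁻ x, ρ n x ^ q ∂μ := by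
  calc ∫⁻ x, (⨆ n, ε n * ρ n x) ^ q ∂μ ≤ ∫⁻ x, ∑' n, ε n ^ q * ρ n x ^ q ∂μ := by
        refine lintegral_mono fun x => ?_
        rw [← ENNReal.orderIsoRpow_apply q hq, OrderIso.map_iSup]
        refine iSup_le fun n => ?_
        rw [ENNReal.orderIsoRpow_apply, ENNReal.mul_rpow_of_nonneg _ _ hq.le]
        exact ENNReal.le_tsum (f := fun n => ε n ^ q * ρ n x ^ q) n
    _ = ∑' n, ∫⁻ x, ε n ^ q * ρ n x ^ q ∂μ :=
        lintegral_tsum fun n => (((hρ n).pow_const q).const_mul _).aemeasurable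
    _ = ∑' n, ε n ^ q * ∫⁻ x, ρ n x ^ q ∂μ := by
        congr 1
        ext n
        exact lintegral_const_mul _ ((hρ n).pow_const q)

theorem lintegral_indicator_rpow {α : Type*} [MeasurableSpace α] {μ : Measure α} {q : ℝ}
    (hq : 0 < q) {U : Set α} (hU : MeasurableSet U) (g : α → ℝ≥0∞) :
    ∫⁻ x, U.indicator g x ^ q ∂μ = ∫⁻ x in U, g x ^ q ∂μ := by
  rw [← lintegral_indicator hU]
  congr 1
  ext x
  by_cases hx : x ∈ U <;> simp [hx, hq]

/-! ### Curves -/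

namespace RectCurve

variable {X : Type*} [MetricSpace X]

theorem continuousOn (γ : RectCurve X) : ContinuousOn γ.toFun (Icc 0 γ.length) := by
  refine LipschitzOnWith.continuousOn (K := 1) fun x hx y hy => ?_
  wlog hxy : x ≤ y generalizing x y
  · rw [edist_comm, edist_comm x]
    exact this y hy x hx (le_of_not_ge hxy)
  have h := eVariationOn.edist_le γ.toFun (s := Icc 0 γ.length ∩ Icc x y)
    ⟨hx, left_mem_Icc.2 hxy⟩ ⟨hy, right_mem_Icc.2 hxy⟩
  rw [γ.unitSpeed hx hy] at h
  refine h.trans (le_of_eq ?_)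
  rw [edist_dist, Real.dist_eq, abs_sub_comm, abs_of_nonneg (sub_nonneg.2 hxy)]
  simp

/-- The part of `γ` between the parameters `s` and `t`. -/
def subcurve (γ : RectCurve X) (s t : ℝ) (hs : 0 ≤ s) (hst : s < t) (ht : t ≤ γ.length) :
    RectCurve X where
  toFun τ := γ.toFun (s + τ)
  length := t - s
  length_pos := sub_pos.2 hst
  unitSpeed := by
    intro x hx y hy
    have h1 : Icc 0 (t - s) ∩ Icc x y = Icc x y :=
      inter_eq_right.2 (Icc_subset_Icc hx.1 hy.2)
    have h2 : Icc 0 γ.length ∩ Icc (s + x) (s + y) = Icc (s + x) (s + y) :=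
      inter_eq_right.2 (Icc_subset_Icc (by linarith [hx.1]) (by linarith [hy.2]))
    have h3 := γ.unitSpeed (x := s + x) ⟨by linarith [hx.1], by linarith [hx.2]⟩
      (y := s + y) ⟨by linarith [hy.1], by linarith [hy.2]⟩
    rw [h2] at h3
    have h4 := eVariationOn.comp_eq_of_monotoneOn γ.toFun (t := Icc x y) (fun τ => s + τ)
      (fun a _ b _ hab => by simpa using hab)
    rw [image_const_add_Icc, h3] at h4
    rw [h1]
    refine h4.trans ?_
    congr 2
    ring

theorem lineIntegral_subcurve (γ : RectCurve X) {s t : ℝ} (hs : 0 ≤ s) (hst : s < t)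
    (ht : t ≤ γ.length) (g : X → ℝ≥0∞) :
    (γ.subcurve s t hs hst ht).lineIntegral g = ∫⁻ τ in Icc s t, g (γ.toFun τ) := by
  change ∫⁻ τ in Icc 0 (t - s), g (γ.toFun (s + τ)) = _
  rw [← lintegral_indicator measurableSet_Icc, ← lintegral_indicator measurableSet_Icc]
  conv_rhs => rw [← lintegral_add_left_eq_self _ s]
  congr 1
  ext τ
  simp only [indicator, mem_Icc]
  congr 1
  rw [eq_iff_iff]
  constructor <;> rintro ⟨h1, h2⟩ <;> constructor <;> linarith

theorem LiesIn.subcurve {γ : RectCurve X} {U : Set X} (h : γ.LiesIn U) {s t : ℝ} (hs : 0 ≤ s)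
    (hst : s < t) (ht : t ≤ γ.length) : (γ.subcurve s t hs hst ht).LiesIn U :=
  fun τ hτ => h _ ⟨by linarith [hτ.1], by
    have : τ ≤ t - s := hτ.2
    linarith⟩

theorem lineIntegral_mono (γ : RectCurve X) {g h : X → ℝ≥0∞}
    (H : ∀ t ∈ Icc 0 γ.length, g (γ.toFun t) ≤ h (γ.toFun t)) :
    γ.lineIntegral g ≤ γ.lineIntegral h :=
  setLIntegral_mono' measurableSet_Icc H

theorem lineIntegral_const_mul_le (γ : RectCurve X) (c : ℝ≥0∞) (g : X → ℝ≥0∞) :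
    c * γ.lineIntegral g ≤ γ.lineIntegral (fun x => c * g x) :=
  lintegral_const_mul_le _ _

theorem LiesIn.lineIntegral_indicator {U : Set X} {γ : RectCurve X} (h : γ.LiesIn U)
    (g : X → ℝ≥0∞) : γ.lineIntegral (U.indicator g) = γ.lineIntegral g :=
  setLIntegral_congr_fun measurableSet_Icc fun t ht => by simp [h t ht]

variable [MeasurableSpace X] [BorelSpace X]

theorem aemeasurable_comp (γ : RectCurve X) {g : X → ℝ≥0∞} (hg : Measurable g) :
    AEMeasurable (fun t => g (γ.toFun t)) (volume.restrict (Icc 0 γ.length)) :=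
  hg.comp_aemeasurable (γ.continuousOn.aemeasurable measurableSet_Icc)

end RectCurve

variable {X : Type*} [MetricSpace X] [MeasurableSpace X]

/-! ### Families of curves of modulus zero -/

/-- The filter of the families of curves whose complement has `q`-modulus zero. -/
def modulusAE (μ : Measure X) {q : ℝ} (hq : 0 < q) : Filter (RectCurve X) :=
  Filter.ofCountableInter
    {s | ∃ ρ : X → ℝ≥0∞, Measurable ρ ∧ ∫⁻ x, ρ x ^ q ∂μ < ⊤ ∧ ∀ γ ∉ s, γ.lineIntegral ρ = ⊤}
    (by
      intro S hS hSl
      rcases S.eq_empty_or_nonempty with rfl | hne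
      · exact ⟨fun _ => 0, measurable_const, by simp [hq], by simp⟩
      obtain ⟨s, rfl⟩ := hS.exists_eq_range hne
      have h : ∀ n, s n ∈ {s | ∃ ρ : X → ℝ≥0∞, Measurable ρ ∧ ∫⁻ x, ρ x ^ q ∂μ < ⊤ ∧
        ∀ γ ∉ s, γ.lineIntegral ρ = ⊤} := fun n => hSl (mem_range_self n)
      choose ρ hρ hρi hρs using h
      obtain ⟨c, hc0, hct, hcs⟩ := exists_pos_forall_tsum_mul_lt_top _ hρi
      -- The weight becomes `c n` after raising to the power `q`, so the integrals are summable;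
      -- being nonzero, it preserves an infinite line integral.
      refine ⟨fun x => ⨆ n, c n ^ q⁻¹ * ρ n x,
        Measurable.iSup fun n => (hρ n).const_mul _, ?_, fun γ hγ => ?_⟩
      · refine (lintegral_iSup_mul_rpow_le μ hq _ ρ hρ).trans_lt ?_
        simpa only [ENNReal.rpow_inv_rpow hq.ne'] using hcs
      · simp only [sInter_range, mem_iInter, not_forall] at hγ
        obtain ⟨n, hn⟩ := hγ
        refine top_le_iff.1 ?_
        calc (⊤ : ℝ≥0∞) = c n ^ q⁻¹ * γ.lineIntegral (ρ n) := by
              rw [hρs n γ hn, ENNReal.mul_top]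
              rw [Ne, ENNReal.rpow_eq_zero_iff_of_pos (inv_pos.2 hq)]
              exact hc0 n
          _ ≤ γ.lineIntegral (fun x => c n ^ q⁻¹ * ρ n x) := γ.lineIntegral_const_mul_le _ _
          _ ≤ _ := γ.lineIntegral_mono fun t _ => le_iSup (fun n => c n ^ q⁻¹ * ρ n _) n)
    (fun s t ⟨ρ, h1, h2, h3⟩ hst => ⟨ρ, h1, h2, fun γ hγ => h3 γ fun h => hγ (hst h)⟩)

instance (μ : Measure X) {q : ℝ} (hq : 0 < q) : CountableInterFilter (modulusAE μ hq) := by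
  unfold modulusAE
  infer_instance

variable {μ : Measure X} {q : ℝ}

theorem eventually_modulusAE (hq : 0 < q) {P : RectCurve X → Prop} :
    (∀ᶠ γ in modulusAE μ hq, P γ) ↔ ∃ ρ : X → ℝ≥0∞, Measurable ρ ∧ ∫⁻ x, ρ x ^ q ∂μ < ⊤ ∧
      ∀ γ, ¬ P γ → γ.lineIntegral ρ = ⊤ :=
  Iff.rfl

/-- Fuglede's characterization: modulus zero means that one `L^q` density has infinite integral over
every curve of the family. Given admissible `ρ n` with rapidly small integrals, the supremum of `n *
ρ n` is such a density. Conversely, `n⁻¹ * ρ` remains admissible while its integral tends to zero.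
-/
theorem modulus_eq_zero_iff (hq : 0 < q) (Γ : Set (RectCurve X)) :
    modulus μ q Γ = 0 ↔ ∀ᶠ γ in modulusAE μ hq, γ ∉ Γ := by
  rw [eventually_modulusAE]
  constructor
  · intro h
    have hpos : ∀ n : ℕ, ((n : ℝ≥0∞) ^ q + 1) ≠ ⊤ := fun n =>
      (ENNReal.add_lt_top.2 ⟨ENNReal.rpow_lt_top_of_nonneg hq.le (by simp), ENNReal.one_lt_top⟩).ne
    obtain ⟨δ, hδ, hsum⟩ := ENNReal.exists_pos_sum_of_countable' (ε := 1) one_ne_zero ℕ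
    have hex : ∀ n : ℕ, ∃ ρ : X → ℝ≥0∞, Measurable ρ ∧ (∀ γ ∈ Γ, 1 ≤ γ.lineIntegral ρ) ∧
        ∫⁻ x, ρ x ^ q ∂μ < δ n / ((n : ℝ≥0∞) ^ q + 1) := by
      intro n
      have hlt : modulus μ q Γ < δ n / ((n : ℝ≥0∞) ^ q + 1) := by
        rw [h]
        exact ENNReal.div_pos (hδ n).ne' (hpos n)
      simp only [modulus, iInf_lt_iff] at hlt
      obtain ⟨ρ, h1, h2, h3⟩ := hlt
      exact ⟨ρ, h1, h2, h3⟩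
    choose ρ hρ hρΓ hρi using hex
    refine ⟨fun x => ⨆ n : ℕ, (n : ℝ≥0∞) * ρ n x,
      Measurable.iSup fun n => (hρ n).const_mul _, ?_, fun γ hγ => ?_⟩
    · refine (lintegral_iSup_mul_rpow_le μ hq _ ρ hρ).trans_lt ?_
      refine lt_of_le_of_lt (ENNReal.tsum_le_tsum fun n => ?_) (hsum.trans ENNReal.one_lt_top)
      calc (n : ℝ≥0∞) ^ q * ∫⁻ x, ρ n x ^ q ∂μ
          ≤ ((n : ℝ≥0∞) ^ q + 1) * (δ n / ((n : ℝ≥0∞) ^ q + 1)) := by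
            gcongr
            · exact le_self_add
            · exact (hρi n).le
        _ ≤ δ n := ENNReal.mul_div_le
    · rw [not_not] at hγ
      refine ENNReal.eq_top_of_forall_nnreal_le fun r => ?_
      obtain ⟨n, hn⟩ := exists_nat_ge r
      calc (r : ℝ≥0∞) ≤ n := by exact_mod_cast hn
        _ ≤ n * γ.lineIntegral (ρ n) := le_mul_of_one_le_right' (hρΓ n γ hγ)
        _ ≤ γ.lineIntegral (fun x => n * ρ n x) := γ.lineIntegral_const_mul_le _ _
        _ ≤ _ := γ.lineIntegral_mono fun t _ => le_iSup (fun n : ℕ => (n : ℝ≥0∞) * ρ n _) n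
  · rintro ⟨ρ, hρ, hρi, hρΓ⟩
    simp only [not_not] at hρΓ
    have hle : ∀ c : ℝ≥0∞, c ≠ 0 → modulus μ q Γ ≤ c ^ q * ∫⁻ x, ρ x ^ q ∂μ := by
      intro c hc
      rw [← lintegral_const_mul _ (hρ.pow_const q)]
      simp_rw [← ENNReal.mul_rpow_of_nonneg _ _ hq.le]
      refine iInf_le_of_le (fun x => c * ρ x) (iInf_le_of_le (hρ.const_mul c)
        (iInf_le_of_le (fun γ hγ => ?_) le_rfl))
      refine le_trans ?_ (γ.lineIntegral_const_mul_le _ _)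
      rw [hρΓ γ hγ, ENNReal.mul_top hc]
      exact le_top
    have hlim : Filter.Tendsto (fun n : ℕ => ((n : ℝ≥0∞)⁻¹) ^ q * ∫⁻ x, ρ x ^ q ∂μ) Filter.atTop
        (nhds 0) := by
      have h1 := (ENNReal.continuous_rpow_const (y := q)).tendsto 0 |>.comp
        ENNReal.tendsto_inv_nat_nhds_zero
      have h2 := ENNReal.Tendsto.mul_const h1 (b := ∫⁻ x, ρ x ^ q ∂μ) (Or.inr hρi.ne)
      simpa [ENNReal.zero_rpow_of_pos hq] using h2
    refine le_antisymm (ge_of_tendsto' hlim fun n => ?_) zero_le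
    exact hle _ (by simp)

theorem eventually_lineIntegral_ne_top (hq : 0 < q) {g : X → ℝ≥0∞} (hg : Measurable g)
    (hgi : ∫⁻ x, g x ^ q ∂μ < ⊤) : ∀ᶠ γ in modulusAE μ hq, γ.lineIntegral g ≠ ⊤ :=
  (eventually_modulusAE hq).2 ⟨g, hg, hgi, fun _ h => not_not.1 h⟩

/-- A density with infinite integral over a subcurve has infinite integral over the whole curve, so
the same density works. -/
theorem eventually_forall_subcurve (hq : 0 < q) {P : RectCurve X → Prop}
    (h : ∀ᶠ γ in modulusAE μ hq, P γ) :
    ∀ᶠ γ in modulusAE μ hq, ∀ (s t : ℝ) (hs : 0 ≤ s) (hst : s < t) (ht : t ≤ γ.length),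
      P (γ.subcurve s t hs hst ht) := by
  rw [eventually_modulusAE] at h ⊢
  obtain ⟨ρ, h1, h2, h3⟩ := h
  refine ⟨ρ, h1, h2, fun γ hγ => ?_⟩
  simp only [not_forall] at hγ
  obtain ⟨s, t, hs, hst, ht, hγ⟩ := hγ
  have := h3 _ hγ
  rw [γ.lineIntegral_subcurve] at this
  exact top_le_iff.1 (this.symm.le.trans (lintegral_mono_set (Icc_subset_Icc hs ht)))


theorem eventually_lineIntegral_ne_top_of_liesIn (hq : 0 < q) {U : Set X} (hU : MeasurableSet U)
    {g : X → ℝ≥0∞} (hg : Measurable g) (hgi : ∫⁻ x in U, g x ^ q ∂μ < ⊤) :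
    ∀ᶠ γ in modulusAE μ hq, γ.LiesIn U → γ.lineIntegral g ≠ ⊤ := by
  rw [← lintegral_indicator_rpow hq hU] at hgi
  filter_upwards [eventually_lineIntegral_ne_top hq (hg.indicator hU) hgi] with γ hγ h
  rwa [← h.lineIntegral_indicator]

variable [BorelSpace X]

/-- The density equal to `∞` on a measurable null set has zero `L^q` integral, yet its line integral
is finite only along curves that spend zero length in the set. -/
theorem eventually_ae_of_ae (hq : 0 < q) {P : X → Prop} (h : ∀ᵐ x ∂μ, P x) :
    ∀ᶠ γ in modulusAE μ hq, ∀ᵐ t, t ∈ Icc 0 γ.length → P (γ.toFun t) := by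
  set N := toMeasurable μ {x | ¬ P x} with hN
  have hNm : MeasurableSet N := measurableSet_toMeasurable _ _
  have hN0 : μ N = 0 := by rw [hN, measure_toMeasurable]; exact h
  have hi : ∫⁻ x, N.indicator (fun _ => (⊤ : ℝ≥0∞)) x ^ q ∂μ < ⊤ := by
    rw [lintegral_indicator_rpow hq hNm, Measure.restrict_eq_zero.2 hN0]
    simp
  filter_upwards [eventually_lineIntegral_ne_top hq (measurable_const.indicator hNm) hi] with γ hγ
  have := ae_lt_top' (γ.aemeasurable_comp (measurable_const.indicator hNm)) hγ
  rw [ae_restrict_iff' measurableSet_Icc] at this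
  filter_upwards [this] with t ht hmem
  by_contra hP
  have hx : γ.toFun t ∈ N := subset_toMeasurable _ _ hP
  simpa [hx] using ht hmem

end Newtonian

/-! ### Extended reals -/

namespace EReal

theorem exists_coe_of_abs_sub_ne_top {x y : EReal} (h : (x - y).abs ≠ ⊤) :
    (∃ a : ℝ, x = a) ∧ ∃ b : ℝ, y = b := by
  induction x <;> induction y <;> simp_all [sub_eq_add_neg]

theorem exists_coe_of_abs_ne_top {x : EReal} (h : x.abs ≠ ⊤) : ∃ a : ℝ, x = a := by
  induction x <;> simp_all

theorem abs_coe (a : ℝ) : (a : EReal).abs = ‖a‖ₑ := by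
  rw [abs_def, ← ofReal_norm, Real.norm_eq_abs]

theorem abs_coe_sub_coe (a b : ℝ) : ((a : EReal) - (b : EReal)).abs = ‖a - b‖ₑ := by
  rw [← coe_sub, abs_coe]

theorem abs_sub_le_add (x y : EReal) : (x - y).abs ≤ x.abs + y.abs := by
  induction x <;> induction y <;> try simp
  rw [abs_coe_sub_coe, abs_coe, abs_coe]
  exact enorm_sub_le

theorem abs_eq_max_toENNReal (x : EReal) : x.abs = max x.toENNReal (-x).toENNReal := by
  induction x with
  | bot => simp
  | top => simp
  | coe a =>
    rw [abs_def, ← coe_neg, toENNReal_of_ne_top (coe_ne_top _), toENNReal_of_ne_top (coe_ne_top _),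
      toReal_coe, toReal_coe, ← ENNReal.ofReal_max]
    rfl

theorem measurable_abs : Measurable EReal.abs := by
  have h : EReal.abs = fun x => max x.toENNReal (-x).toENNReal := funext abs_eq_max_toENNReal
  rw [h]
  exact measurable_ereal_toENNReal.max (measurable_ereal_toENNReal.comp measurable_neg)

end EReal

namespace Newtonian

variable {X : Type*} [MetricSpace X]

/-! ### Absolute continuity along curves -/

/-- The function `u` is finite and absolutely continuous along `γ`, and its derivative along `γ` is
bounded by `g`. -/
structure AbsContAlong (u : X → EReal) (g : X → ℝ≥0∞) (γ : RectCurve X) : Prop where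
  coe_toReal : ∀ t ∈ Icc 0 γ.length, u (γ.toFun t) = ((u (γ.toFun t)).toReal : EReal)
  absCont : AbsolutelyContinuousOnInterval (fun t => (u (γ.toFun t)).toReal) 0 γ.length
  deriv_le : ∀ᵐ t, t ∈ Icc 0 γ.length →
    ‖deriv (fun t => (u (γ.toFun t)).toReal) t‖ₑ ≤ g (γ.toFun t)

namespace AbsContAlong

variable {u v : X → EReal} {g h : X → ℝ≥0∞} {γ : RectCurve X}

theorem of_eq {f : ℝ → ℝ} (hu : ∀ t ∈ Icc 0 γ.length, u (γ.toFun t) = (f t : EReal))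
    (hf : AbsolutelyContinuousOnInterval f 0 γ.length)
    (hd : ∀ᵐ t, t ∈ Icc 0 γ.length → ‖deriv f t‖ₑ ≤ g (γ.toFun t)) : AbsContAlong u g γ := by
  have heq : ∀ t ∈ Icc 0 γ.length, (u (γ.toFun t)).toReal = f t := fun t ht => by
    rw [hu t ht, EReal.toReal_coe]
  refine ⟨fun t ht => by rw [heq t ht, hu t ht], ?_, ?_⟩
  · refine .of_dist_le_add hf hf fun s hs t ht => ?_
    rw [uIcc_of_le γ.length_pos.le] at hs ht
    rw [heq s hs, heq t ht]
    exact le_add_of_nonneg_right dist_nonneg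
  -- Agreement on the closed interval fixes the two-sided derivative only at interior points; the
  -- two end points are discarded as a null set.
  · filter_upwards [hd, Measure.ae_ne volume 0, Measure.ae_ne volume γ.length] with t h1 h2 h3 ht
    have hn : (fun t => (u (γ.toFun t)).toReal) =ᶠ[nhds t] f := by
      filter_upwards [Icc_mem_nhds (lt_of_le_of_ne ht.1 h2.symm) (lt_of_le_of_ne ht.2 h3)] with s hs
      exact heq s hs
    rw [hn.deriv_eq]
    exact h1 ht

theorem iInf {ι : Type*} [Countable ι] [Nonempty ι] {g : ι → X → ℝ≥0∞}
    (hu : ∀ i, AbsContAlong u (g i) γ) : AbsContAlong u (fun x => ⨅ i, g i x) γ := by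
  refine ⟨(hu (Classical.arbitrary ι)).coe_toReal, (hu (Classical.arbitrary ι)).absCont, ?_⟩
  filter_upwards [ae_all_iff.2 fun i => (hu i).deriv_le] with t ht hmem
  exact le_iInf fun i => ht i hmem

theorem ae_differentiableAt (hu : AbsContAlong u g γ) : ∀ᵐ t, t ∈ Icc 0 γ.length →
    DifferentiableAt ℝ (fun t => (u (γ.toFun t)).toReal) t := by
  simpa only [uIcc_of_le γ.length_pos.le] using hu.absCont.ae_differentiableAt

theorem upperGradientIneq (hu : AbsContAlong u g γ) : UpperGradientIneq u g γ := by
  unfold UpperGradientIneq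
  rw [hu.coe_toReal 0 (left_mem_Icc.2 γ.length_pos.le),
    hu.coe_toReal _ (right_mem_Icc.2 γ.length_pos.le), EReal.abs_coe_sub_coe]
  refine (hu.absCont.enorm_sub_le_lintegral_enorm_deriv γ.length_pos.le).trans ?_
  exact lintegral_mono_ae ((ae_restrict_iff' measurableSet_Icc).2 hu.deriv_le)

theorem sub (hu : AbsContAlong u g γ) (hv : AbsContAlong v h γ) :
    AbsContAlong (fun x => u x - v x) (fun x => g x + h x) γ := by
  refine of_eq (f := fun t => (u (γ.toFun t)).toReal - (v (γ.toFun t)).toReal) (fun t ht => ?_)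
    (hu.absCont.sub hv.absCont) ?_
  · rw [EReal.coe_sub, ← hu.coe_toReal t ht, ← hv.coe_toReal t ht]
  · filter_upwards [hu.ae_differentiableAt, hv.ae_differentiableAt, hu.deriv_le, hv.deriv_le]
      with t h1 h2 h3 h4 ht
    rw [deriv_fun_sub (h1 ht) (h2 ht)]
    exact enorm_sub_le.trans (add_le_add (h3 ht) (h4 ht))

end AbsContAlong

variable [MeasurableSpace X]

/-- Curves inside `U` do not see a density outside `U`. Cutting it off there makes exceptional
families for `μ.restrict U` exceptional for `μ`, so a single filter serves all `U`. -/
theorem isWeakUpperGradient_iff {μ : Measure X} {q : ℝ} (hq : 0 < q) {U : Set X}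
    (hU : MeasurableSet U) {u : X → EReal} {g : X → ℝ≥0∞} :
    IsWeakUpperGradient μ q U u g ↔ Measurable g ∧
      ∀ᶠ γ in modulusAE μ hq, γ.LiesIn U → UpperGradientIneq u g γ := by
  refine and_congr_right fun _ => ?_
  rw [modulus_eq_zero_iff hq, eventually_modulusAE, eventually_modulusAE]
  simp only [mem_ofPred_eq, not_and, not_not, Classical.not_imp]
  constructor
  · rintro ⟨ρ, h1, h2, h3⟩
    refine ⟨U.indicator ρ, h1.indicator hU, ?_, fun γ hγ => ?_⟩
    · rwa [lintegral_indicator_rpow hq hU]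
    · rw [hγ.1.lineIntegral_indicator]
      exact h3 γ hγ
  · rintro ⟨ρ, h1, h2, h3⟩
    exact ⟨ρ, h1, (lintegral_mono' Measure.restrict_le_self le_rfl).trans_lt h2, h3⟩

variable {μ : Measure X} {q : ℝ} {U : Set X} {u : X → EReal} {g : X → ℝ≥0∞}

theorem isWeakUpperGradient_of_absContAlong (hq : 0 < q) (hU : MeasurableSet U)
    (hg : Measurable g) (hu : ∀ᶠ γ in modulusAE μ hq, γ.LiesIn U → AbsContAlong u g γ) :
    IsWeakUpperGradient μ q U u g :=
  (isWeakUpperGradient_iff hq hU).2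
    ⟨hg, hu.mono fun _ h1 h2 => (h1 h2).upperGradientIneq⟩

variable [BorelSpace X]

/-- Every point of the curve is an end point of some subcurve, and a finite line integral forces
finite end values. The rest is the one-variable criterion. -/
theorem absContAlong_of_forall_subcurve {γ : RectCurve X} (hg : Measurable g)
    (hfin : γ.lineIntegral g ≠ ⊤)
    (hsub : ∀ (s t : ℝ) (hs : 0 ≤ s) (hst : s < t) (ht : t ≤ γ.length),
      UpperGradientIneq u g (γ.subcurve s t hs hst ht)) : AbsContAlong u g γ := by
  have hle : ∀ s t, 0 ≤ s → s < t → t ≤ γ.length →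
      (u (γ.toFun s) - u (γ.toFun t)).abs ≤ ∫⁻ τ in Icc s t, g (γ.toFun τ) := by
    intro s t hs hst ht
    have := hsub s t hs hst ht
    unfold UpperGradientIneq at this
    rw [γ.lineIntegral_subcurve] at this
    simpa [RectCurve.subcurve] using this
  have hlt : ∀ s t, 0 ≤ s → t ≤ γ.length → ∫⁻ τ in Icc s t, g (γ.toFun τ) ≠ ⊤ := fun s t hs ht =>
    ne_top_of_le_ne_top hfin (lintegral_mono_set (Icc_subset_Icc hs ht))
  have hcoe : ∀ t ∈ Icc 0 γ.length, ∃ a : ℝ, u (γ.toFun t) = a := by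
    intro t ht
    rcases ht.1.eq_or_lt with rfl | h0
    · exact (EReal.exists_coe_of_abs_sub_ne_top (ne_top_of_le_ne_top (hlt 0 _ le_rfl le_rfl)
        (hle 0 _ le_rfl γ.length_pos le_rfl))).1
    · exact (EReal.exists_coe_of_abs_sub_ne_top (ne_top_of_le_ne_top (hlt 0 t le_rfl ht.2)
        (hle 0 t le_rfl h0 ht.2))).2
  have hcoe' : ∀ t ∈ Icc 0 γ.length, u (γ.toFun t) = ((u (γ.toFun t)).toReal : EReal) := by
    intro t ht
    obtain ⟨a, ha⟩ := hcoe t ht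
    rw [ha, EReal.toReal_coe]
  have := absolutelyContinuousOnInterval_of_le_lintegral
    (f := fun t => (u (γ.toFun t)).toReal) γ.length_pos.le (γ.aemeasurable_comp hg) hfin
    fun s t hs hst ht => by
      have := hle s t hs hst ht
      rwa [hcoe' s ⟨hs, hst.le.trans ht⟩, hcoe' t ⟨hs.trans hst.le, ht⟩,
        EReal.abs_coe_sub_coe] at this
  exact ⟨hcoe', this.1, this.2⟩

theorem IsWeakUpperGradient.eventually_absContAlong (hq : 0 < q) (hU : MeasurableSet U)
    (h : IsWeakUpperGradient μ q U u g) (hgi : ∫⁻ x in U, g x ^ q ∂μ < ⊤) :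
    ∀ᶠ γ in modulusAE μ hq, γ.LiesIn U → AbsContAlong u g γ := by
  obtain ⟨hg, h⟩ := (isWeakUpperGradient_iff hq hU).1 h
  filter_upwards [eventually_forall_subcurve hq h,
    eventually_lineIntegral_ne_top_of_liesIn hq hU hg hgi] with γ h1 h2 hγ
  exact absContAlong_of_forall_subcurve hg (h2 hγ)
    fun s t hs hst ht => h1 s t hs hst ht (hγ.subcurve hs hst ht)

/-! ### Minimal weak upper gradients -/

theorem isWeakUpperGradient_iInf {ι : Type*} [Countable ι] [Nonempty ι] (hq : 0 < q)
    (hU : MeasurableSet U) {g : ι → X → ℝ≥0∞} (h : ∀ i, IsWeakUpperGradient μ q U u (g i))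
    (hgi : ∀ i, ∫⁻ x in U, g i x ^ q ∂μ < ⊤) :
    IsWeakUpperGradient μ q U u (fun x => ⨅ i, g i x) := by
  refine isWeakUpperGradient_of_absContAlong hq hU (Measurable.iInf fun i => (h i).1) ?_
  have := eventually_countable_forall.2 fun i => (h i).eventually_absContAlong hq hU (hgi i)
  filter_upwards [this] with γ h1 h2
  exact AbsContAlong.iInf fun i => h1 i h2

/-- The pointwise infimum of a minimizing sequence is again a weak upper gradient and attains the
least `L^q` integral. Taking its minimum with any other `h` cannot lower the integral, so that
minimum equals it a.e. -/
theorem exists_isMinimalWeakUpperGradient (hq : 0 < q) (hU : MeasurableSet U)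
    (hex : ∃ g : X → ℝ≥0∞, IsWeakUpperGradient μ q U u g ∧ ∫⁻ x in U, g x ^ q ∂μ < ⊤) :
    ∃ g, IsMinimalWeakUpperGradient μ q U u g := by
  set S : Set ℝ≥0∞ := {I | ∃ g : X → ℝ≥0∞, IsWeakUpperGradient μ q U u g ∧
    ∫⁻ x in U, g x ^ q ∂μ < ⊤ ∧ ∫⁻ x in U, g x ^ q ∂μ = I} with hS
  obtain ⟨g₀, h0, h0i⟩ := hex
  have hS' : ∀ g : X → ℝ≥0∞, IsWeakUpperGradient μ q U u g → ∫⁻ x in U, g x ^ q ∂μ < ⊤ →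
      ∫⁻ x in U, g x ^ q ∂μ ∈ S := fun g h hi => ⟨g, h, hi, rfl⟩
  obtain ⟨I, -, hlim, hmem⟩ := exists_seq_tendsto_sInf ⟨_, hS' g₀ h0 h0i⟩ (OrderBot.bddBelow S)
  choose g hg hgi hgI using hmem
  have hinf := isWeakUpperGradient_iInf hq hU hg hgi
  have hle : ∫⁻ x in U, (⨅ n, g n x) ^ q ∂μ ≤ sInf S := by
    refine ge_of_tendsto' hlim fun n => ?_
    rw [← hgI n]
    exact lintegral_mono fun x => ENNReal.rpow_le_rpow (iInf_le _ n) hq.le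
  have hlt : ∫⁻ x in U, (⨅ n, g n x) ^ q ∂μ < ⊤ :=
    hle.trans_lt ((sInf_le (hS' g₀ h0 h0i)).trans_lt h0i)
  refine ⟨_, hinf, hlt, fun h hh hhi => ?_⟩
  -- Indexing the pair by `Bool` lets the countable infimum lemma treat the minimum of two
  -- functions.
  set k : Bool → X → ℝ≥0∞ := fun b => bif b then h else fun x => ⨅ n, g n x with hk
  have hkw : ∀ b, IsWeakUpperGradient μ q U u (k b) := by
    rintro (_ | _)
    · exact hinf
    · exact hh
  have hki : ∀ b, ∫⁻ x in U, k b x ^ q ∂μ < ⊤ := by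
    rintro (_ | _)
    · exact hlt
    · exact hhi
  have hkle : ∀ b, ∫⁻ x in U, (⨅ b, k b x) ^ q ∂μ ≤ ∫⁻ x in U, k b x ^ q ∂μ := fun b =>
    lintegral_mono fun x => ENNReal.rpow_le_rpow (iInf_le _ b) hq.le
  have hae := ae_eq_of_ae_le_of_lintegral_le (μ := μ.restrict U)
    (f := fun x => (⨅ b, k b x) ^ q) (g := fun x => (⨅ n, g n x) ^ q)
    (Filter.Eventually.of_forall fun x =>
      ENNReal.rpow_le_rpow (iInf_le (fun b => k b x) false) hq.le)
    ((hkle false).trans_lt (hki false)).ne (hinf.1.pow_const q).aemeasurable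
    (hle.trans (sInf_le (hS' _ (isWeakUpperGradient_iInf hq hU hkw hki)
      ((hkle false).trans_lt (hki false)))))
  filter_upwards [hae] with x hx
  have := ENNReal.rpow_left_injective hq.ne' hx
  calc (⨅ n, g n x) = ⨅ b, k b x := this.symm
    _ ≤ k true x := iInf_le (fun b => k b x) true
    _ = h x := rfl

theorem isMinimalWeakUpperGradient_minGrad (hq : 0 < q) (hU : MeasurableSet U)
    (hex : ∃ g : X → ℝ≥0∞, IsWeakUpperGradient μ q U u g ∧ ∫⁻ x in U, g x ^ q ∂μ < ⊤) :
    IsMinimalWeakUpperGradient μ q U u (minGrad μ q U u) := by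
  have h := exists_isMinimalWeakUpperGradient hq hU hex
  unfold minGrad
  rw [dif_pos h]
  exact h.choose_spec

end Newtonian

namespace Newtonian

/-! ### Convexity of the energy integrand -/

section Convexity

theorem eq_of_rpow_midpoint_eq {q : ℝ} (hq : 1 < q) {x y : ℝ≥0∞} (hx : x ≠ ⊤) (hy : y ≠ ⊤)
    (h : (2⁻¹ * x + 2⁻¹ * y) ^ q = 2⁻¹ * x ^ q + 2⁻¹ * y ^ q) : x = y := by
  lift x to ℝ≥0 using hx
  lift y to ℝ≥0 using hy
  by_contra hne
  have hxy : (x : ℝ) ≠ y := fun h => hne (by rw [NNReal.eq h])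
  have hlt : ((2⁻¹ : ℝ) • (x : ℝ) + (2⁻¹ : ℝ) • (y : ℝ)) ^ q <
      (2⁻¹ : ℝ) • (x : ℝ) ^ q + (2⁻¹ : ℝ) • (y : ℝ) ^ q :=
    (strictConvexOn_rpow hq).2 x.coe_nonneg y.coe_nonneg hxy (by norm_num) (by norm_num)
      (by norm_num)
  have h2 := congrArg ENNReal.toReal h
  have hq0 : 0 ≤ q := by linarith
  rw [← ENNReal.toReal_rpow, ENNReal.toReal_add (by finiteness) (by finiteness),
    ENNReal.toReal_add (by finiteness) (by finiteness)] at h2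
  simp only [ENNReal.toReal_mul, ← ENNReal.toReal_rpow, ENNReal.toReal_inv, ENNReal.toReal_ofNat,
    ENNReal.coe_toReal] at h2
  simp only [smul_eq_mul] at hlt
  exact hlt.ne h2

variable {α : Type*} [MeasurableSpace α] {μ : Measure α} {p q : ℝ} {A B G₁ G₂ G : α → ℝ≥0∞}

/-- With `M` the mean of `G₁` and `G₂`, the energy of `G₁` is at most that of `G`, hence of `M`,
which by convexity is at most the common energy of `G₁` and `G₂`. All are equal and finite, so the
pointwise convexity inequality is an equality a.e. -/
theorem ae_eq_of_energy_midpoint_le (hp : 1 < p) (hq : 1 < q) (hA : AEMeasurable A μ)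
    (hB : AEMeasurable B μ) (hB0 : ∀ x, B x ≠ 0) (hBt : ∀ x, B x ≠ ⊤)
    (hG₁ : AEMeasurable G₁ μ) (hG₂ : AEMeasurable G₂ μ)
    (hG : ∀ᵐ x ∂μ, G x ≤ 2⁻¹ * G₁ x + 2⁻¹ * G₂ x)
    (hfin : ∫⁻ x, A x * G₁ x ^ p ∂μ + ∫⁻ x, B x * G₁ x ^ q ∂μ < ⊤)
    (h12 : ∫⁻ x, A x * G₁ x ^ p ∂μ + ∫⁻ x, B x * G₁ x ^ q ∂μ =
      ∫⁻ x, A x * G₂ x ^ p ∂μ + ∫⁻ x, B x * G₂ x ^ q ∂μ)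
    (hle : ∫⁻ x, A x * G₁ x ^ p ∂μ + ∫⁻ x, B x * G₁ x ^ q ∂μ ≤
      ∫⁻ x, A x * G x ^ p ∂μ + ∫⁻ x, B x * G x ^ q ∂μ) : G₁ =ᵐ[μ] G₂ := by
  set M : α → ℝ≥0∞ := fun x => 2⁻¹ * G₁ x + 2⁻¹ * G₂ x with hM
  set K : (α → ℝ≥0∞) → α → ℝ≥0∞ := fun g x => A x * g x ^ p + B x * g x ^ q with hK
  have hint : ∀ g, AEMeasurable g μ →
      ∫⁻ x, K g x ∂μ = ∫⁻ x, A x * g x ^ p ∂μ + ∫⁻ x, B x * g x ^ q ∂μ := fun g hg =>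
    lintegral_add_left' (hA.mul (hg.pow_const p)) _
  have hMm : AEMeasurable M μ := (hG₁.const_mul _).add (hG₂.const_mul _)
  have hKm : ∀ g, AEMeasurable g μ → AEMeasurable (K g) μ := fun g hg =>
    (hA.mul (hg.pow_const p)).add (hB.mul (hg.pow_const q))
  have hcp : ∀ r : ℝ, 1 < r → ∀ x, M x ^ r ≤ 2⁻¹ * G₁ x ^ r + 2⁻¹ * G₂ x ^ r := fun r hr x =>
    ENNReal.rpow_arith_mean_le_arith_mean2_rpow _ _ _ _ ENNReal.inv_two_add_inv_two hr.le
  have hap : ∀ x, A x * M x ^ p ≤ 2⁻¹ * (A x * G₁ x ^ p) + 2⁻¹ * (A x * G₂ x ^ p) := fun x =>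
    (mul_le_mul_right (hcp p hp x) (A x)).trans_eq (by ring)
  have hbq : ∀ x, B x * M x ^ q ≤ 2⁻¹ * (B x * G₁ x ^ q) + 2⁻¹ * (B x * G₂ x ^ q) := fun x =>
    (mul_le_mul_right (hcp q hq x) (B x)).trans_eq (by ring)
  have hKle : ∀ x, K M x ≤ 2⁻¹ * K G₁ x + 2⁻¹ * K G₂ x := fun x =>
    (add_le_add (hap x) (hbq x)).trans_eq (by simp only [hK]; ring)
  have hKint : ∫⁻ x, 2⁻¹ * K G₁ x + 2⁻¹ * K G₂ x ∂μ = ∫⁻ x, K G₁ x ∂μ := by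
    rw [lintegral_add_left' ((hKm _ hG₁).const_mul _), lintegral_const_mul'' _ (hKm _ hG₁),
      lintegral_const_mul'' _ (hKm _ hG₂), hint G₂ hG₂, ← h12, ← hint G₁ hG₁, ← add_mul,
      ENNReal.inv_two_add_inv_two, one_mul]
  rw [← hint G₁ hG₁] at hfin hle
  have hGM : ∫⁻ x, K G₁ x ∂μ ≤ ∫⁻ x, K M x ∂μ := by
    rw [hint M hMm]
    refine hle.trans (add_le_add (lintegral_mono_ae ?_) (lintegral_mono_ae ?_)) <;>
      filter_upwards [hG] with x hx <;> gcongr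
  have hKM : ∫⁻ x, K M x ∂μ ≠ ⊤ :=
    ((lintegral_mono hKle).trans_lt (hKint.trans_lt hfin)).ne
  have hae := ae_eq_of_ae_le_of_lintegral_le (Filter.Eventually.of_forall hKle) hKM
    (((hKm _ hG₁).const_mul _).add ((hKm _ hG₂).const_mul _)) (hKint.trans_le hGM)
  filter_upwards [hae, ae_lt_top' (hKm _ hMm) hKM] with x hx hxt
  -- The `p`-part satisfies its own convexity inequality and is finite, so it can be cancelled;
  -- equality is left in the `q`-part, where `B` is nonzero and finite.
  have hpt : A x * M x ^ p ≠ ⊤ := (lt_of_le_of_lt le_self_add hxt).ne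
  have hsum : A x * M x ^ p + (2⁻¹ * (B x * G₁ x ^ q) + 2⁻¹ * (B x * G₂ x ^ q)) ≤
      A x * M x ^ p + B x * M x ^ q := by
    refine (add_le_add_left (hap x) _).trans (le_of_eq ?_)
    change _ = K M x
    rw [hx]
    simp only [hK]
    ring
  have h3 := le_antisymm (hbq x) ((ENNReal.add_le_add_iff_left hpt).1 hsum)
  have h4 : B x * M x ^ q = B x * (2⁻¹ * G₁ x ^ q + 2⁻¹ * G₂ x ^ q) := h3.trans (by ring)
  have h5 := (ENNReal.mul_right_inj (hB0 x) (hBt x)).1 h4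
  have hq0 : 0 < q := by linarith
  have h6 : 2⁻¹ * G₁ x ^ q + 2⁻¹ * G₂ x ^ q ≠ ⊤ := by
    rw [← h5]
    intro htop
    have : B x * M x ^ q < ⊤ := lt_of_le_of_lt le_add_self hxt
    rw [htop, ENNReal.mul_top (hB0 x)] at this
    exact this.ne rfl
  have hne : ∀ z : ℝ≥0∞, 2⁻¹ * z ^ q ≠ ⊤ → z ≠ ⊤ := by
    rintro z hz rfl
    simp [ENNReal.top_rpow_of_pos hq0, ENNReal.mul_top] at hz
  exact eq_of_rpow_midpoint_eq hq (hne _ (ENNReal.add_ne_top.1 h6).1)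
    (hne _ (ENNReal.add_ne_top.1 h6).2) h5

/-- Removing `G₁` on `S` does not lower the finite energy, so the integrand of `G₁` already vanishes
a.e. on `S`; its `B`-term then gives `G₁ = 0`. -/
theorem ae_eq_zero_of_energy_indicator_compl_le (hp : 0 < p) (hq : 0 < q) (hA : AEMeasurable A μ)
    (hB : AEMeasurable B μ) (hB0 : ∀ x, B x ≠ 0) (hG₁ : AEMeasurable G₁ μ) {S : Set α}
    (hS : MeasurableSet S) (hG : ∀ᵐ x ∂μ, G x ≤ Sᶜ.indicator G₁ x)
    (hfin : ∫⁻ x, A x * G₁ x ^ p ∂μ + ∫⁻ x, B x * G₁ x ^ q ∂μ < ⊤)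
    (hle : ∫⁻ x, A x * G₁ x ^ p ∂μ + ∫⁻ x, B x * G₁ x ^ q ∂μ ≤
      ∫⁻ x, A x * G x ^ p ∂μ + ∫⁻ x, B x * G x ^ q ∂μ) : ∀ᵐ x ∂μ, x ∈ S → G₁ x = 0 := by
  set K : (α → ℝ≥0∞) → α → ℝ≥0∞ := fun g x => A x * g x ^ p + B x * g x ^ q with hK
  have hint : ∀ g, AEMeasurable g μ →
      ∫⁻ x, K g x ∂μ = ∫⁻ x, A x * g x ^ p ∂μ + ∫⁻ x, B x * g x ^ q ∂μ := fun g hg =>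
    lintegral_add_left' (hA.mul (hg.pow_const p)) _
  have hKm : AEMeasurable (K G₁) μ := (hA.mul (hG₁.pow_const p)).add (hB.mul (hG₁.pow_const q))
  rw [← hint G₁ hG₁] at hfin hle
  have hKle : ∀ x, K (Sᶜ.indicator G₁) x ≤ K G₁ x := fun x => by
    have : Sᶜ.indicator G₁ x ≤ G₁ x := indicator_le_self _ _ x
    simp only [hK]
    gcongr
  have hGM : ∫⁻ x, K G₁ x ∂μ ≤ ∫⁻ x, K (Sᶜ.indicator G₁) x ∂μ := by
    rw [hint _ (hG₁.indicator hS.compl)]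
    refine hle.trans (add_le_add (lintegral_mono_ae ?_) (lintegral_mono_ae ?_)) <;>
      filter_upwards [hG] with x hx <;> gcongr
  have hae := ae_eq_of_ae_le_of_lintegral_le (Filter.Eventually.of_forall hKle)
    ((lintegral_mono hKle).trans_lt hfin).ne hKm hGM
  filter_upwards [hae] with x hx hxS
  have h0 : K (Sᶜ.indicator G₁) x = 0 := by
    simp [hK, hxS, hp, hq]
  rw [h0] at hx
  have h1 := (add_eq_zero.1 hx.symm).2
  rcases mul_eq_zero.1 h1 with h | h
  · exact absurd h (hB0 x)
  · exact (ENNReal.rpow_eq_zero_iff_of_pos hq).1 h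

end Convexity

/-! ### Competitors -/

namespace AbsContAlong

variable {X : Type*} [MetricSpace X] {u₁ u₂ : X → EReal} {g₁ g₂ : X → ℝ≥0∞} {γ : RectCurve X}

/-- Passing through `toReal` avoids `∞ - ∞`; the default value at infinite points is harmless
because both functions are finite along `γ`. -/
theorem midpoint (h₁ : AbsContAlong u₁ g₁ γ) (h₂ : AbsContAlong u₂ g₂ γ) :
    AbsContAlong (fun x => ((2⁻¹ * (u₁ x).toReal + 2⁻¹ * (u₂ x).toReal : ℝ) : EReal))
      (fun x => 2⁻¹ * g₁ x + 2⁻¹ * g₂ x) γ := by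
  refine of_eq (fun t _ => rfl) ((h₁.absCont.const_mul _).add (h₂.absCont.const_mul _)) ?_
  have e2 : ‖(2⁻¹ : ℝ)‖ₑ = 2⁻¹ := by
    rw [enorm_inv (by norm_num)]
    congr 1
    rw [← ofReal_norm]
    norm_num
  filter_upwards [h₁.ae_differentiableAt, h₂.ae_differentiableAt, h₁.deriv_le, h₂.deriv_le]
    with t d1 d2 l1 l2 ht
  rw [deriv_fun_add ((d1 ht).const_mul _) ((d2 ht).const_mul _), deriv_const_mul _ (d1 ht),
    deriv_const_mul _ (d2 ht)]
  refine (enorm_add_le _ _).trans ?_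
  rw [enorm_mul, enorm_mul, e2]
  gcongr
  · exact l1 ht
  · exact l2 ht

/-- At each parameter the function equals `u₁`, `u₂` or `c`, and almost everywhere its derivative is
that of the one it equals. On `S` this is the constant `c`. -/
theorem max_min (h₁ : AbsContAlong u₁ g₁ γ) (h₂ : AbsContAlong u₂ g₂ γ) {c : ℝ} {S : Set X}
    (hS : ∀ x ∈ S, u₁ x < c ∧ c < u₂ x) :
    AbsContAlong (fun x => max (u₁ x) (min (u₂ x) c))
      (Sᶜ.indicator fun x => max (g₁ x) (g₂ x)) γ := by
  have hac := h₁.absCont.max (h₂.absCont.min (.const c 0 γ.length))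
  refine of_eq (fun t ht => ?_) hac ?_
  · rw [EReal.coe_strictMono.monotone.map_max, EReal.coe_strictMono.monotone.map_min,
      ← h₁.coe_toReal t ht, ← h₂.coe_toReal t ht]
  have hd := hac.ae_differentiableAt
  rw [uIcc_of_le γ.length_pos.le] at hd
  filter_upwards [h₁.ae_differentiableAt, h₂.ae_differentiableAt, h₁.deriv_le, h₂.deriv_le, hd,
    ae_deriv_eq_of_eq (fun t => max (u₁ (γ.toFun t)).toReal (min (u₂ (γ.toFun t)).toReal c))
      (fun t => (u₁ (γ.toFun t)).toReal),
    ae_deriv_eq_of_eq (fun t => max (u₁ (γ.toFun t)).toReal (min (u₂ (γ.toFun t)).toReal c))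
      (fun t => (u₂ (γ.toFun t)).toReal),
    ae_deriv_eq_of_eq (fun t => max (u₁ (γ.toFun t)).toReal (min (u₂ (γ.toFun t)).toReal c))
      (fun _ => c)] with t d1 d2 l1 l2 d e1 e2 e3 ht
  have hc0 : max (u₁ (γ.toFun t)).toReal (min (u₂ (γ.toFun t)).toReal c) = c →
      deriv (fun t => max (u₁ (γ.toFun t)).toReal (min (u₂ (γ.toFun t)).toReal c)) t = 0 := by
    intro h
    rw [e3 h (d ht) (differentiableAt_const c), deriv_const]
  by_cases hx : γ.toFun t ∈ S
  · obtain ⟨hlt1, hlt2⟩ := hS _ hx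
    rw [h₁.coe_toReal t ht, EReal.coe_lt_coe_iff] at hlt1
    rw [h₂.coe_toReal t ht, EReal.coe_lt_coe_iff] at hlt2
    rw [hc0 (by rw [min_eq_right hlt2.le, max_eq_right hlt1.le])]
    simp
  · rw [indicator_of_mem (mem_compl hx)]
    rcases max_choice (u₁ (γ.toFun t)).toReal (min (u₂ (γ.toFun t)).toReal c) with h | h
    · rw [e1 h (d ht) (d1 ht)]
      exact (l1 ht).trans (le_max_left _ _)
    · rcases min_choice (u₂ (γ.toFun t)).toReal c with h' | h'
      · rw [e2 (h.trans h') (d ht) (d2 ht)]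
        exact (l2 ht).trans (le_max_right _ _)
      · rw [hc0 (h.trans h')]
        simp

end AbsContAlong

variable {X : Type*} [MetricSpace X] [MeasurableSpace X] {μ : Measure X} {q : ℝ}
  {U : Set X} {u v w : X → EReal}

theorem memNewtonian_of_abs_le_add (hq : 1 ≤ q) (hw : AEMeasurable w (μ.restrict U))
    (hu : MemNewtonian μ q U u) (hv : MemNewtonian μ q U v)
    (hle : ∀ x, (w x).abs ≤ (u x).abs + (v x).abs) {g : X → ℝ≥0∞}
    (hg : IsWeakUpperGradient μ q U w g) (hgi : ∫⁻ x in U, g x ^ q ∂μ < ⊤) :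
    MemNewtonian μ q U w := by
  refine ⟨hw, lt_of_le_of_lt (lintegral_mono fun x => ?_)
    (ENNReal.lintegral_rpow_add_lt_top_of_lintegral_rpow_lt_top
      (EReal.measurable_abs.comp_aemeasurable hu.1) hu.2.1 hv.2.1 hq), g, hg, hgi⟩
  exact ENNReal.rpow_le_rpow (hle x) (by linarith)

variable [BorelSpace X]

theorem MemNewtonian.sub (hq : 1 ≤ q) (hU : MeasurableSet U) (hu : MemNewtonian μ q U u)
    (hv : MemNewtonian μ q U v) : MemNewtonian μ q U (fun x => u x - v x) := by
  have hq0 : 0 < q := by linarith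
  obtain ⟨g, hg, hgi⟩ := hu.2.2
  obtain ⟨h, hh, hhi⟩ := hv.2.2
  refine memNewtonian_of_abs_le_add (g := fun x => g x + h x) hq ?_ hu hv
    (fun x => EReal.abs_sub_le_add _ _) ?_
    (ENNReal.lintegral_rpow_add_lt_top_of_lintegral_rpow_lt_top hg.1.aemeasurable hgi hhi hq)
  · simp only [sub_eq_add_neg]
    exact hu.1.add (measurable_neg.comp_aemeasurable hv.1)
  · refine isWeakUpperGradient_of_absContAlong hq0 hU (hg.1.add hh.1) ?_
    filter_upwards [hg.eventually_absContAlong hq0 hU hgi,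
      hh.eventually_absContAlong hq0 hU hhi] with γ h1 h2 hγ
    exact (h1 hγ).sub (h2 hγ)

/-- A Newtonian function on `U` that is dominated by a function with zero boundary values has zero
boundary values. -/
theorem MemNewtonian.memNewtonianZero_of_abs_le (hq : 1 ≤ q) (hU : MeasurableSet U)
    (hw : MemNewtonian μ q U w) (hv : MemNewtonianZero μ q U v)
    (hle : ∀ x ∈ U, (w x).abs ≤ (v x).abs) : MemNewtonianZero μ q U w := by
  have hq0 : 0 < q := by linarith
  obtain ⟨g, hg, hgi⟩ := hw.2.2
  obtain ⟨hvm, hvi, h, hh, hhi⟩ := hv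
  have hle' : ∀ x, (U.indicator w x).abs ≤ (U.indicator v x).abs := by
    intro x
    by_cases hx : x ∈ U
    · simpa [hx] using hle x hx
    · simp [hx]
  refine ⟨?_, lt_of_le_of_lt (lintegral_mono fun x => ?_) hvi,
    fun x => 2 * h x + U.indicator g x, (isWeakUpperGradient_iff hq0 .univ).2 ⟨?_, ?_⟩, ?_⟩
  · rw [Measure.restrict_univ]
    exact (aemeasurable_indicator_iff hU).2 hw.1
  · exact ENNReal.rpow_le_rpow (hle' x) hq0.le
  · exact (hh.1.const_mul 2).add (hg.1.indicator hU)
  · filter_upwards [hh.eventually_absContAlong hq0 .univ hhi,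
      ((isWeakUpperGradient_iff hq0 hU).1 hg).2] with γ h1 h2 _
    replace h1 := h1 fun _ _ => mem_univ _
    -- Inside `U` the gradient `g` suffices. A curve that leaves `U` meets a zero of the extended
    -- `v`, so `v`, and with it `w`, is bounded by `∫ h` at each end; the two ends account for the
    -- factor `2`.
    by_cases hγU : γ.LiesIn U
    · have h3 := h2 hγU
      unfold UpperGradientIneq at h3 ⊢
      rw [indicator_of_mem (hγU 0 (left_mem_Icc.2 γ.length_pos.le)),
        indicator_of_mem (hγU _ (right_mem_Icc.2 γ.length_pos.le))]
      refine h3.trans (γ.lineIntegral_mono fun t ht => ?_)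
      rw [indicator_of_mem (hγU t ht)]
      exact le_add_self
    · unfold RectCurve.LiesIn at hγU
      push Not at hγU
      obtain ⟨τ, hτ, hτU⟩ := hγU
      have hF : ∀ s t, s ∈ Icc 0 γ.length → t ∈ Icc 0 γ.length → s ≤ t →
          ‖(U.indicator v (γ.toFun s)).toReal - (U.indicator v (γ.toFun t)).toReal‖ₑ ≤
            γ.lineIntegral h := by
        intro s t hs ht hst
        have hac : AbsolutelyContinuousOnInterval
            (fun t => (U.indicator v (γ.toFun t)).toReal) s t := by
          refine h1.absCont.mono ?_
          rw [uIcc_of_le hst, uIcc_of_le γ.length_pos.le]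
          exact Icc_subset_Icc hs.1 ht.2
        refine (hac.enorm_sub_le_lintegral_enorm_deriv hst).trans ?_
        refine (lintegral_mono_set (Icc_subset_Icc hs.1 ht.2)).trans ?_
        exact lintegral_mono_ae ((ae_restrict_iff' measurableSet_Icc).2 h1.deriv_le)
      have h0 : (U.indicator v (γ.toFun τ)).toReal = 0 := by simp [hτU]
      have hl : (0 : ℝ) ∈ Icc 0 γ.length := left_mem_Icc.2 γ.length_pos.le
      have hr : γ.length ∈ Icc 0 γ.length := right_mem_Icc.2 γ.length_pos.le
      have ha := hF 0 τ hl hτ hτ.1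
      have hb := hF τ _ hτ hr hτ.2
      rw [h0, sub_zero] at ha
      rw [h0, zero_sub, enorm_neg] at hb
      unfold UpperGradientIneq
      refine (EReal.abs_sub_le_add _ _).trans ((add_le_add (hle' _) (hle' _)).trans ?_)
      rw [h1.coe_toReal 0 hl, h1.coe_toReal _ hr, EReal.abs_coe, EReal.abs_coe]
      calc _ ≤ γ.lineIntegral h + γ.lineIntegral h := add_le_add ha hb
        _ = 2 * γ.lineIntegral h := (two_mul _).symm
        _ ≤ γ.lineIntegral (fun x => 2 * h x) := γ.lineIntegral_const_mul_le _ _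
        _ ≤ _ := γ.lineIntegral_mono fun t _ => le_self_add
  · refine ENNReal.lintegral_rpow_add_lt_top_of_lintegral_rpow_lt_top
      (hh.1.const_mul 2).aemeasurable ?_ ?_ hq
    · simp_rw [ENNReal.mul_rpow_of_nonneg _ _ hq0.le]
      rw [lintegral_const_mul _ (hh.1.pow_const q)]
      exact ENNReal.mul_lt_top (ENNReal.rpow_lt_top_of_nonneg hq0.le (by simp)) hhi
    · rwa [Measure.restrict_univ, lintegral_indicator_rpow hq0 hU]

end Newtonian

namespace Newtonian

/-! ### Lowering the exponent on sets of finite measure. -/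

theorem le_one_add_rpow {p q : ℝ} (hpq : 0 ≤ p) (h : p ≤ q) (x : ℝ≥0∞) : x ^ p ≤ 1 + x ^ q := by
  rcases le_total x 1 with hx | hx
  · exact (ENNReal.rpow_le_one hx hpq).trans le_self_add
  · exact (ENNReal.rpow_le_rpow_of_exponent_le hx h).trans le_add_self

theorem setLIntegral_rpow_lt_top {α : Type*} [MeasurableSpace α] {μ : Measure α} {p q : ℝ}
    (hp : 0 ≤ p) (hpq : p ≤ q) {s : Set α} (hs : μ s < ⊤)
    {f : α → ℝ≥0∞} (hf : ∫⁻ x in s, f x ^ q ∂μ < ⊤) : ∫⁻ x in s, f x ^ p ∂μ < ⊤ := by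
  refine (lintegral_mono fun x => le_one_add_rpow hp hpq (f x)).trans_lt ?_
  rw [lintegral_add_left measurable_const, setLIntegral_const, one_mul]
  exact ENNReal.add_lt_top.2 ⟨hs, hf⟩

variable {X : Type*} [MetricSpace X]

/-! ### Functions with vanishing gradient -/

theorem AbsContAlong.ae_deriv_le_of_subcurve {u : X → EReal} {g : X → ℝ≥0∞} {γ : RectCurve X}
    {r s : ℝ} {hr : 0 ≤ r} {hrs : r < s} {hs : s ≤ γ.length}
    (h : AbsContAlong u g (γ.subcurve r s hr hrs hs)) :
    ∀ᵐ t, t ∈ Icc r s → ‖deriv (fun t => (u (γ.toFun t)).toReal) t‖ₑ ≤ g (γ.toFun t) := by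
  have h1 := (measurePreserving_sub_right volume r).quasiMeasurePreserving.ae h.deriv_le
  filter_upwards [h1] with t ht hmem
  have h2 := ht ⟨sub_nonneg.2 hmem.1, sub_le_sub_right hmem.2 r⟩
  simp only [RectCurve.subcurve] at h2
  rw [deriv_comp_const_add (fun t => (u (γ.toFun t)).toReal)] at h2
  simpa using h2

variable [MeasurableSpace X] {μ : Measure X} {p q : ℝ} {U : Set X}

theorem MemNewtonian.ae_coe_toReal (hq : 0 < q) {w : X → EReal} (hw : MemNewtonian μ q U w) :
    ∀ᵐ x ∂(μ.restrict U), w x = ((w x).toReal : EReal) := by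
  have hm : AEMeasurable (fun x => (w x).abs ^ q) (μ.restrict U) :=
    (EReal.measurable_abs.comp_aemeasurable hw.1).pow_const q
  filter_upwards [ae_lt_top' hm hw.2.1.ne] with x hx
  obtain ⟨a, ha⟩ := EReal.exists_coe_of_abs_ne_top (x := w x) fun h => by
    rw [h, ENNReal.top_rpow_of_pos hq] at hx
    exact hx.ne rfl
  rw [ha, EReal.toReal_coe]

/-- By the Poincaré inequality, a Newtonian function with vanishing gradient is constant on every
ball. -/
theorem ae_eq_setAverage_of_isWeakUpperGradient_zero (hμ : IsDoubling μ) (hp : 1 < p)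
    (hpq : p < q) (hPI : SupportsPoincare μ p) {w : X → EReal} (hw : MemNewtonian μ q univ w)
    (h0 : IsWeakUpperGradient μ q univ w (fun _ => 0)) (y : X) {r : ℝ} (hr : 0 < r) :
    ∀ᵐ x ∂(μ.restrict (ball y r)), (w x).toReal = ⨍ z in ball y r, (w z).toReal ∂μ := by
  have hp0 : 0 < p := by linarith
  have hq0 : 0 < q := by linarith
  obtain ⟨D, -, hD⟩ := hμ
  obtain ⟨C, l, hC, hl, hPI⟩ := hPI
  have hwm : AEMeasurable (fun x => (w x).toReal) μ := by
    have := hw.1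
    rw [Measure.restrict_univ] at this
    exact measurable_ereal_toReal.comp_aemeasurable this
  have hwi := hw.2.1
  rw [Measure.restrict_univ] at hwi
  have hint : ∀ (z : X) (R : ℝ), IntegrableOn (fun x => (w x).toReal) (ball z R) μ := by
    intro z R
    have hb : μ (ball z R) < ⊤ := by
      rcases le_or_gt R 0 with hR | hR
      · simp [ball_eq_empty.2 hR]
      · exact (hD z R hR).2.2
    refine ⟨hwm.restrict.aestronglyMeasurable, ?_⟩
    have := setLIntegral_rpow_lt_top (p := 1) zero_le_one (hp.trans hpq).le hb
      ((setLIntegral_le_lintegral _ _).trans_lt hwi)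
    refine lt_of_le_of_lt (lintegral_mono fun x => ?_) this
    rw [ENNReal.rpow_one]
    dsimp only
    induction w x with
    | bot => simp
    | top => simp
    | coe a => rw [EReal.toReal_coe, EReal.abs_coe]
  obtain ⟨ρ, hρ, hρi, hρΓ⟩ :=
    (eventually_modulusAE hq0).1 ((isWeakUpperGradient_iff hq0 .univ).1 h0).2
  -- The Poincaré inequality is assumed for genuine upper gradients only. Adding `c * ρ`, infinite
  -- in integral on the exceptional curves, turns the weak gradient `0` into one; `c` tends to zero
  -- at the end. Since `ρ` is in `L^q` and `p < q`, its `p`-average over a ball is finite.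
  have hug : ∀ c : ℝ≥0∞, c ≠ 0 →
      IsUpperGradient univ (fun x => ((w x).toReal : EReal)) (fun x => c * ρ x) := by
    intro c hc
    refine ⟨hρ.const_mul c, fun γ hγ => ?_⟩
    unfold UpperGradientIneq
    by_cases hineq : UpperGradientIneq w (fun _ => 0) γ
    · unfold UpperGradientIneq at hineq
      have hz : γ.lineIntegral (fun _ : X => (0 : ℝ≥0∞)) = 0 := lintegral_zero
      rw [hz] at hineq
      obtain ⟨⟨a, ha⟩, b, hb⟩ := EReal.exists_coe_of_abs_sub_ne_top
        (ne_top_of_le_ne_top ENNReal.zero_ne_top hineq)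
      rw [ha, hb] at hineq
      dsimp only
      rw [ha, hb, EReal.toReal_coe, EReal.toReal_coe]
      exact hineq.trans zero_le
    · have htop := hρΓ γ fun h => hineq (h hγ)
      refine le_trans ?_ (γ.lineIntegral_const_mul_le c ρ)
      rw [htop, ENNReal.mul_top hc]
      exact le_top
  have hlr : 0 < l * r := by positivity
  set A : ℝ≥0∞ := ⨍⁻ x in ball y (l * r), ρ x ^ p ∂μ with hA
  have hAt : A < ⊤ := laverage_lt_top (setLIntegral_rpow_lt_top hp0.le hpq.le (hD y _ hlr).2.2
    ((setLIntegral_le_lintegral _ _).trans_lt hρi)).ne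
  have hbound : ∀ c : ℝ≥0∞, c ≠ 0 →
      ⨍⁻ x in ball y r, ENNReal.ofReal |(w x).toReal - ⨍ z in ball y r, (w z).toReal ∂μ| ∂μ ≤
        c * (ENNReal.ofReal (C * r) * A ^ (1 / p)) := by
    intro c hc
    refine (hPI _ hint _ (hug c hc) y r hr).trans (le_of_eq ?_)
    have : ⨍⁻ x in ball y (l * r), (c * ρ x) ^ p ∂μ = c ^ p * A := by
      simp_rw [ENNReal.mul_rpow_of_nonneg _ _ hp0.le, hA, laverage_eq']
      exact lintegral_const_mul _ (hρ.pow_const p)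
    rw [this, ENNReal.mul_rpow_of_nonneg _ _ (by positivity), one_div,
      ENNReal.rpow_rpow_inv hp0.ne', mul_left_comm]
  have hzero : ⨍⁻ x in ball y r,
      ENNReal.ofReal |(w x).toReal - ⨍ z in ball y r, (w z).toReal ∂μ| ∂μ = 0 := by
    have hK : ENNReal.ofReal (C * r) * A ^ (1 / p) ≠ ⊤ :=
      ENNReal.mul_ne_top ENNReal.ofReal_ne_top
        (ENNReal.rpow_lt_top_of_nonneg (by positivity) hAt.ne).ne
    have hlim := ENNReal.Tendsto.mul_const (b := ENNReal.ofReal (C * r) * A ^ (1 / p))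
      ENNReal.tendsto_inv_nat_nhds_zero (Or.inr hK)
    rw [zero_mul] at hlim
    exact le_antisymm (ge_of_tendsto' hlim fun n => hbound _ (by simp)) zero_le
  rw [setLAverage_eq, ENNReal.div_eq_zero_iff] at hzero
  have hz := hzero.resolve_right (hD y r hr).2.2.ne
  rw [lintegral_eq_zero_iff' ((hwm.restrict.sub_const _).abs).ennreal_ofReal] at hz
  filter_upwards [hz] with x hx
  simp only [Pi.zero_apply, ENNReal.ofReal_eq_zero] at hx
  exact sub_eq_zero.1 (abs_nonpos_iff.1 hx)

variable [BorelSpace X]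

/-- Zero boundary values make the extended difference absolutely continuous along whole curves,
including those that cross the boundary of `U`. Its derivative vanishes a.e. on its zero set. At
other parameters the curve is locally in the open set `U`, and the derivative is at most `g₁ + g₂ =
0`. -/
theorem isWeakUpperGradient_zero_of_ae_eq_zero (hq : 0 < q) (hU : IsOpen U) {u₁ u₂ : X → EReal}
    {g₁ g₂ : X → ℝ≥0∞} (h₁ : IsWeakUpperGradient μ q U u₁ g₁)
    (h₁i : ∫⁻ x in U, g₁ x ^ q ∂μ < ⊤) (h₂ : IsWeakUpperGradient μ q U u₂ g₂)
    (h₂i : ∫⁻ x in U, g₂ x ^ q ∂μ < ⊤) (h₀ : MemNewtonianZero μ q U (fun x => u₁ x - u₂ x))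
    (hg : ∀ᵐ x ∂(μ.restrict U), u₁ x ≠ u₂ x → g₁ x = 0 ∧ g₂ x = 0) :
    IsWeakUpperGradient μ q univ (U.indicator fun x => u₁ x - u₂ x) (fun _ => 0) := by
  obtain ⟨-, -, h, hh, hhi⟩ := h₀
  rw [ae_restrict_iff' hU.measurableSet] at hg
  refine isWeakUpperGradient_of_absContAlong hq .univ measurable_const ?_
  filter_upwards [hh.eventually_absContAlong hq .univ hhi,
    eventually_forall_subcurve hq (h₁.eventually_absContAlong hq hU.measurableSet h₁i),
    eventually_forall_subcurve hq (h₂.eventually_absContAlong hq hU.measurableSet h₂i),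
    eventually_ae_of_ae hq hg] with γ k k1 k2 kae hγ
  replace k := k hγ
  refine ⟨k.coe_toReal, k.absCont, ?_⟩
  set F : ℝ → ℝ := fun t => ((U.indicator fun x => u₁ x - u₂ x) (γ.toFun t)).toReal with hF
  -- The bounds for `u₁` and `u₂` hold only on subcurves inside `U`, each up to its own null set.
  -- Rational end points keep the union of these sets null.
  have hrat : ∀ᵐ t, ∀ r s : ℚ, 0 ≤ (r : ℝ) → (s : ℝ) ≤ γ.length → t ∈ Ioo (r : ℝ) s →
      (∀ τ ∈ Icc (r : ℝ) s, γ.toFun τ ∈ U) →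
      ‖deriv F t‖ₑ ≤ g₁ (γ.toFun t) + g₂ (γ.toFun t) := by
    rw [ae_all_iff]
    intro r
    rw [ae_all_iff]
    intro s
    by_cases hc : 0 ≤ (r : ℝ) ∧ (r : ℝ) < s ∧ (s : ℝ) ≤ γ.length ∧
      ∀ τ ∈ Icc (r : ℝ) s, γ.toFun τ ∈ U
    · obtain ⟨hr, hrs, hs, hin⟩ := hc
      have hl : (γ.subcurve r s hr hrs hs).LiesIn U := fun τ hτ => hin _ ⟨by linarith [hτ.1], by
        have : τ ≤ (s : ℝ) - r := hτ.2
        linarith⟩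
      filter_upwards [((k1 r s hr hrs hs hl).sub (k2 r s hr hrs hs hl)).ae_deriv_le_of_subcurve]
        with t ht _ _ hmem _
      have heq : F =ᶠ[nhds t] fun t => (u₁ (γ.toFun t) - u₂ (γ.toFun t)).toReal := by
        filter_upwards [Ioo_mem_nhds hmem.1 hmem.2] with τ hτ
        simp only [hF]
        rw [indicator_of_mem (hin τ (Ioo_subset_Icc_self hτ))]
      rw [heq.deriv_eq]
      exact ht (Ioo_subset_Icc_self hmem)
    · refine Filter.Eventually.of_forall fun t hr hs hmem hin => absurd ?_ hc
      exact ⟨hr, hmem.1.trans hmem.2, hs, hin⟩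
  filter_upwards [hrat, k.ae_differentiableAt, ae_deriv_eq_of_eq F (fun _ => 0), kae,
    Measure.ae_ne volume 0, Measure.ae_ne volume γ.length] with t t1 t2 t3 t4 t5 t6 ht
  by_cases hFt : F t = 0
  · rw [t3 hFt (t2 ht) (differentiableAt_const _)]
    simp
  have htU : γ.toFun t ∈ U := by
    by_contra hn
    exact hFt (by simp [hF, hn])
  have hne : u₁ (γ.toFun t) ≠ u₂ (γ.toFun t) := by
    intro heq
    refine hFt ?_
    simp only [hF]
    rw [indicator_of_mem htU, heq]
    -- For infinite values the difference is `⊥`, which `toReal` also sends to `0`.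
    induction u₂ (γ.toFun t) with
    | bot => simp
    | top => simp
    | coe a => rw [← EReal.coe_sub, EReal.toReal_coe, sub_self]
  have hI : Icc 0 γ.length ∈ nhds t :=
    Icc_mem_nhds (lt_of_le_of_ne ht.1 t5.symm) (lt_of_le_of_ne ht.2 t6)
  have hcont : ContinuousAt γ.toFun t := γ.continuousOn.continuousAt hI
  have hnear : {τ | τ ∈ Icc 0 γ.length ∧ γ.toFun τ ∈ U} ∈ nhds t := by
    filter_upwards [hI, hcont (hU.mem_nhds htU)] with τ a1 a2
    exact ⟨a1, a2⟩
  obtain ⟨l, m, ⟨hlt, htm⟩, hsub⟩ := mem_nhds_iff_exists_Ioo_subset.1 hnear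
  obtain ⟨r, hr1, hr2⟩ := exists_rat_btwn hlt
  obtain ⟨s, hs1, hs2⟩ := exists_rat_btwn htm
  have hrsub : ∀ τ ∈ Icc (r : ℝ) s, τ ∈ Icc 0 γ.length ∧ γ.toFun τ ∈ U := fun τ hτ =>
    hsub ⟨hr1.trans_le hτ.1, hτ.2.trans_lt hs2⟩
  have hrs : (r : ℝ) ≤ s := (hr2.trans hs1).le
  have h3 := t1 r s (hrsub r (left_mem_Icc.2 hrs)).1.1 (hrsub s (right_mem_Icc.2 hrs)).1.2
    ⟨hr2, hs1⟩ fun τ hτ => (hrsub τ hτ).2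
  obtain ⟨e1, e2⟩ := t4 ht htU hne
  rwa [e1, e2, add_zero] at h3

/-- Concentric balls, all containing one fixed piece of `S` of positive measure, exhaust the space.
On each of them `w` is a.e. constant, and that piece identifies the constant as `0`. -/
theorem ae_eq_zero_of_isWeakUpperGradient_zero (hμ : IsDoubling μ) (hp : 1 < p)
    (hpq : p < q) (hPI : SupportsPoincare μ p) {w : X → EReal} (hw : MemNewtonian μ q univ w)
    (h0 : IsWeakUpperGradient μ q univ w (fun _ => 0)) {S : Set X} (hS : 0 < μ S)
    (hwS : ∀ x ∈ S, w x = 0) : ∀ᵐ x ∂μ, w x = 0 := by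
  obtain ⟨y, -⟩ : S.Nonempty := by
    by_contra hne
    rw [not_nonempty_iff_eq_empty] at hne
    simp [hne] at hS
  obtain ⟨N, hN⟩ : ∃ N : ℕ, 0 < μ (S ∩ ball y (N + 1)) := by
    by_contra! hall
    have hcov : S ⊆ ⋃ N : ℕ, S ∩ ball y (N + 1) := by
      intro x hx
      obtain ⟨n, hn⟩ := exists_nat_gt (dist x y)
      exact mem_iUnion.2 ⟨n, hx, mem_ball.2 (hn.trans (by linarith))⟩
    exact hS.ne' (measure_mono_null hcov
      (measure_iUnion_null fun n => le_antisymm (hall n) zero_le))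
  have hball : ∀ n : ℕ, ∀ᵐ x ∂μ, x ∈ ball y (N + n + 1) → (w x).toReal = 0 := by
    intro n
    have hr : (0 : ℝ) < N + n + 1 := by positivity
    have h1 := ae_eq_setAverage_of_isWeakUpperGradient_zero hμ hp hpq hPI hw h0 y hr
    rw [ae_restrict_iff' measurableSet_ball] at h1
    obtain ⟨x, hxS, hx⟩ := nonempty_of_measure_ne_zero (μ := μ)
      (s := (S ∩ ball y (N + 1)) ∩ {x | x ∈ ball y (N + n + 1) →
        (w x).toReal = ⨍ z in ball y (N + n + 1), (w z).toReal ∂μ})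
      (by
        rw [measure_inter_conull h1]
        exact hN.ne')
    have hx' := hx (ball_subset_ball (by linarith [(Nat.cast_nonneg n : (0 : ℝ) ≤ n)]) hxS.2)
    rw [hwS x hxS.1, EReal.toReal_zero] at hx'
    rwa [← hx'] at h1
  have hfin := hw.ae_coe_toReal (by linarith)
  rw [Measure.restrict_univ] at hfin
  filter_upwards [ae_all_iff.2 hball, hfin] with x hx hx'
  obtain ⟨n, hn⟩ := exists_nat_gt (dist x y)
  rw [hx', hx n (mem_ball.2 (by linarith [(Nat.cast_nonneg N : (0 : ℝ) ≤ N)])), EReal.coe_zero]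

/-! ### Capacity of the set where a null function does not vanish -/

/-- Along almost every curve `w` is continuous and zero at almost every parameter, hence zero
throughout. So almost every curve misses `E`, and the characteristic function of `E` is admissible
with zero norm. -/
theorem capacity_eq_zero_of_ae_eq_zero (hq : 0 < q) {w : X → EReal}
    (hw : MemNewtonian μ q univ w) (hw0 : ∀ᵐ x ∂μ, w x = 0) {E : Set X}
    (hE : ∀ x ∈ E, w x ≠ 0) : capacity μ q E = 0 := by
  obtain ⟨-, -, h, hh, hhi⟩ := hw
  have hae : ∀ᵐ x ∂μ, E.indicator (fun _ => (1 : EReal)) x = 0 := by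
    filter_upwards [hw0] with x hx
    exact indicator_of_notMem (fun hxE => hE x hxE hx) _
  have hg : IsWeakUpperGradient μ q univ (E.indicator fun _ => (1 : EReal)) (fun _ => 0) := by
    refine (isWeakUpperGradient_iff hq .univ).2 ⟨measurable_const, ?_⟩
    filter_upwards [hh.eventually_absContAlong hq .univ hhi, eventually_ae_of_ae hq hw0]
      with γ h1 h2 hγ
    replace h1 := h1 hγ
    have hcont := h1.absCont.continuousOn
    rw [uIcc_of_le γ.length_pos.le] at hcont
    have hz := Measure.eqOn_Icc_of_ae_eq volume γ.length_pos.ne (g := fun _ => (0 : ℝ))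
      (by
        refine (ae_restrict_iff' measurableSet_Icc).2 (h2.mono fun t ht hmem => ?_)
        simp only [ht hmem, EReal.toReal_zero]) hcont continuousOn_const
    have hnot : ∀ t ∈ Icc 0 γ.length, γ.toFun t ∉ E := fun t ht hmem =>
      hE _ hmem (by
        have := hz ht
        dsimp only at this
        rw [h1.coe_toReal t ht, this, EReal.coe_zero])
    unfold UpperGradientIneq
    rw [indicator_of_notMem (hnot 0 (left_mem_Icc.2 γ.length_pos.le)),
      indicator_of_notMem (hnot _ (right_mem_Icc.2 γ.length_pos.le))]
    simp
  have hgi : ∫⁻ x in univ, (fun _ : X => (0 : ℝ≥0∞)) x ^ q ∂μ < ⊤ := by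
    simp [ENNReal.zero_rpow_of_pos hq]
  have h0 : ∫⁻ x, (E.indicator (fun _ => (1 : EReal)) x).abs ^ q ∂μ = 0 := by
    refine (lintegral_congr_ae ?_).trans lintegral_zero
    filter_upwards [hae] with x hx
    rw [hx, EReal.abs_zero, ENNReal.zero_rpow_of_pos hq]
  have hmem : MemNewtonian μ q univ (E.indicator fun _ => (1 : EReal)) := by
    refine ⟨?_, ?_, _, hg, hgi⟩
    · rw [Measure.restrict_univ]
      exact (aemeasurable_const (b := (0 : EReal))).congr (Filter.EventuallyEq.symm hae)
    · rw [Measure.restrict_univ, h0]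
      exact ENNReal.zero_lt_top
  have hmin := (isMinimalWeakUpperGradient_minGrad hq .univ hmem.2.2).2.2 _ hg hgi
  rw [Measure.restrict_univ] at hmin
  have h1 : ∫⁻ x, minGrad μ q univ (E.indicator fun _ => (1 : EReal)) x ^ q ∂μ = 0 := by
    refine (lintegral_congr_ae ?_).trans lintegral_zero
    filter_upwards [hmin] with x hx
    rw [le_antisymm hx zero_le, ENNReal.zero_rpow_of_pos hq]
  refine le_antisymm (iInf_le_of_le _ (iInf_le_of_le hmem
    (iInf_le_of_le (fun x hx => indicator_of_mem hx _) ?_))) zero_le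
  rw [h0, h1, add_zero]

end Newtonian

namespace Newtonian

variable {X : Type*} [MetricSpace X] [MeasurableSpace X] [BorelSpace X] {μ : Measure X} {p q : ℝ}
  {a b : X → ℝ} {U : Set X} {u₁ u₂ u v : X → EReal}

/-! ### Comparison with the competitors -/

theorem abs_coe_toReal_le (x : EReal) : ((x.toReal : ℝ) : EReal).abs ≤ x.abs := by
  induction x <;> simp

theorem abs_midpoint_le (x y : EReal) :
    ((2⁻¹ * x.toReal + 2⁻¹ * y.toReal : ℝ) : EReal).abs ≤ x.abs + y.abs := by
  refine le_trans ?_ (add_le_add (abs_coe_toReal_le x) (abs_coe_toReal_le y))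
  rw [EReal.abs_def, EReal.abs_def, EReal.abs_def,
    ← ENNReal.ofReal_add (abs_nonneg _) (abs_nonneg _)]
  refine ENNReal.ofReal_le_ofReal ((abs_add_le _ _).trans ?_)
  rw [abs_mul, abs_mul, abs_of_pos (by norm_num : (0 : ℝ) < 2⁻¹)]
  linarith [abs_nonneg x.toReal, abs_nonneg y.toReal]

/-- This domination, like `abs_sub_max_min_le`, is what gives the competitor the boundary values of
`u₁`. If `x` or `y` is infinite, the right side is `⊤`. -/
theorem abs_sub_midpoint_le (x y : EReal) :
    (x - ((2⁻¹ * x.toReal + 2⁻¹ * y.toReal : ℝ) : EReal)).abs ≤ (x - y).abs := by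
  by_cases h : (x - y).abs = ⊤
  · rw [h]
    exact le_top
  obtain ⟨⟨r, rfl⟩, s, rfl⟩ := EReal.exists_coe_of_abs_sub_ne_top h
  rw [EReal.toReal_coe, EReal.toReal_coe, ← EReal.coe_sub, ← EReal.coe_sub, EReal.abs_def,
    EReal.abs_def]
  refine ENNReal.ofReal_le_ofReal ?_
  have : r - (2⁻¹ * r + 2⁻¹ * s) = 2⁻¹ * (r - s) := by ring
  rw [this, abs_mul, abs_of_pos (by norm_num : (0 : ℝ) < 2⁻¹)]
  linarith [abs_nonneg (r - s)]

theorem max_min_coe_eq_coe (r s c : ℝ) :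
    max (r : EReal) (min (s : EReal) c) = ((max r (min s c) : ℝ) : EReal) := by
  rw [EReal.coe_strictMono.monotone.map_max, EReal.coe_strictMono.monotone.map_min]

theorem abs_max_min_le (x y : EReal) (c : ℝ) : (max x (min y c)).abs ≤ x.abs + y.abs := by
  rcases max_choice x (min y c) with h | h
  · rw [h]
    exact le_self_add
  by_cases hfin : x.abs + y.abs = ⊤
  · rw [hfin]
    exact le_top
  obtain ⟨h1, h2⟩ := ENNReal.add_ne_top.1 hfin
  obtain ⟨r, rfl⟩ := EReal.exists_coe_of_abs_ne_top h1
  obtain ⟨s, rfl⟩ := EReal.exists_coe_of_abs_ne_top h2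
  rw [max_min_coe_eq_coe, EReal.abs_def, EReal.abs_def, EReal.abs_def,
    ← ENNReal.ofReal_add (abs_nonneg _) (abs_nonneg _)]
  refine ENNReal.ofReal_le_ofReal (abs_le.2 ⟨?_, max_le ?_ ((min_le_left _ _).trans ?_)⟩)
  · linarith [le_max_left r (min s c), neg_abs_le r, abs_nonneg s]
  · linarith [le_abs_self r, abs_nonneg s]
  · linarith [le_abs_self s, abs_nonneg r]

theorem abs_sub_max_min_le (x y : EReal) (c : ℝ) : (x - max x (min y c)).abs ≤ (x - y).abs := by
  by_cases h : (x - y).abs = ⊤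
  · rw [h]
    exact le_top
  obtain ⟨⟨r, rfl⟩, s, rfl⟩ := EReal.exists_coe_of_abs_sub_ne_top h
  rw [max_min_coe_eq_coe, ← EReal.coe_sub, ← EReal.coe_sub, EReal.abs_def, EReal.abs_def]
  refine ENNReal.ofReal_le_ofReal ?_
  rw [abs_sub_comm, abs_of_nonneg (sub_nonneg.2 (le_max_left r (min s c)))]
  refine sub_le_iff_le_add.2 (max_le (by linarith [abs_nonneg (r - s)])
    ((min_le_left _ _).trans ?_))
  linarith [neg_abs_le (r - s)]

/-! ### Competitors built from two minimizers. -/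

theorem IsMinimizer.minGrad_spec (hq : 0 < q) (hU : MeasurableSet U)
    (h : IsMinimizer μ p q a b U u) : IsMinimalWeakUpperGradient μ q U u (minGrad μ q U u) :=
  isMinimalWeakUpperGradient_minGrad hq hU h.1.2.2

theorem IsMinimizer.exists_midpoint (hq : 1 ≤ q) (hU : MeasurableSet U)
    (h₁ : IsMinimizer μ p q a b U u₁) (h₂ : IsMinimizer μ p q a b U u₂)
    (h₀ : MemNewtonianZero μ q U (fun x => u₁ x - u₂ x)) :
    ∃ v : X → EReal, energy μ p q a b U u₁ ≤ energy μ p q a b U v ∧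
      ∀ᵐ x ∂(μ.restrict U),
        minGrad μ q U v x ≤ 2⁻¹ * minGrad μ q U u₁ x + 2⁻¹ * minGrad μ q U u₂ x := by
  have hq0 : 0 < q := by linarith
  obtain ⟨hg₁, hg₁i, -⟩ := h₁.minGrad_spec hq0 hU
  obtain ⟨hg₂, hg₂i, -⟩ := h₂.minGrad_spec hq0 hU
  set v : X → EReal := fun x => ((2⁻¹ * (u₁ x).toReal + 2⁻¹ * (u₂ x).toReal : ℝ) : EReal) with hv
  have hvg : IsWeakUpperGradient μ q U v
      (fun x => 2⁻¹ * minGrad μ q U u₁ x + 2⁻¹ * minGrad μ q U u₂ x) := by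
    refine isWeakUpperGradient_of_absContAlong hq0 hU
      ((hg₁.1.const_mul _).add (hg₂.1.const_mul _)) ?_
    filter_upwards [hg₁.eventually_absContAlong hq0 hU hg₁i,
      hg₂.eventually_absContAlong hq0 hU hg₂i] with γ k1 k2 hγ
    exact (k1 hγ).midpoint (k2 hγ)
  have hvi : ∫⁻ x in U, (2⁻¹ * minGrad μ q U u₁ x + 2⁻¹ * minGrad μ q U u₂ x) ^ q ∂μ < ⊤ := by
    refine lt_of_le_of_lt (lintegral_mono fun x => ENNReal.rpow_le_rpow (add_le_add ?_ ?_) hq0.le)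
      (ENNReal.lintegral_rpow_add_lt_top_of_lintegral_rpow_lt_top hg₁.1.aemeasurable hg₁i hg₂i hq)
    all_goals exact mul_le_of_le_one_left' (by simp)
  have hvm : MemNewtonian μ q U v := by
    refine memNewtonian_of_abs_le_add hq ?_ h₁.1 h₂.1 (fun x => abs_midpoint_le _ _) hvg hvi
    exact ((((measurable_ereal_toReal.comp_aemeasurable h₁.1.1).const_mul _).add
      ((measurable_ereal_toReal.comp_aemeasurable h₂.1.1).const_mul _))).coe_real_ereal
  have hv0 : MemNewtonianZero μ q U (fun x => u₁ x - v x) :=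
    (h₁.1.sub hq hU hvm).memNewtonianZero_of_abs_le hq hU h₀ fun x _ => abs_sub_midpoint_le _ _
  exact ⟨v, h₁.2 v hvm hv0,
    (isMinimalWeakUpperGradient_minGrad hq0 hU hvm.2.2).2.2 _ hvg hvi⟩

theorem IsMinimizer.exists_max_min (hq : 1 ≤ q) (hU : MeasurableSet U)
    (h₁ : IsMinimizer μ p q a b U u₁) (h₂ : IsMinimizer μ p q a b U u₂)
    (h₀ : MemNewtonianZero μ q U (fun x => u₁ x - u₂ x)) (c : ℝ) {S : Set X}
    (hS : MeasurableSet S) (hSc : ∀ x ∈ S, u₁ x < c ∧ c < u₂ x) :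
    ∃ v : X → EReal, energy μ p q a b U u₁ ≤ energy μ p q a b U v ∧
      ∀ᵐ x ∂(μ.restrict U), minGrad μ q U v x ≤
        Sᶜ.indicator (fun x => max (minGrad μ q U u₁ x) (minGrad μ q U u₂ x)) x := by
  have hq0 : 0 < q := by linarith
  obtain ⟨hg₁, hg₁i, -⟩ := h₁.minGrad_spec hq0 hU
  obtain ⟨hg₂, hg₂i, -⟩ := h₂.minGrad_spec hq0 hU
  set v : X → EReal := fun x => max (u₁ x) (min (u₂ x) c) with hv
  have hvg : IsWeakUpperGradient μ q U v
      (Sᶜ.indicator fun x => max (minGrad μ q U u₁ x) (minGrad μ q U u₂ x)) := by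
    refine isWeakUpperGradient_of_absContAlong hq0 hU ((hg₁.1.max hg₂.1).indicator hS.compl) ?_
    filter_upwards [hg₁.eventually_absContAlong hq0 hU hg₁i,
      hg₂.eventually_absContAlong hq0 hU hg₂i] with γ k1 k2 hγ
    exact (k1 hγ).max_min (k2 hγ) hSc
  have hvi : ∫⁻ x in U,
      (Sᶜ.indicator (fun x => max (minGrad μ q U u₁ x) (minGrad μ q U u₂ x)) x) ^ q ∂μ < ⊤ := by
    refine lt_of_le_of_lt (lintegral_mono fun x => ENNReal.rpow_le_rpow ?_ hq0.le)
      (ENNReal.lintegral_rpow_add_lt_top_of_lintegral_rpow_lt_top hg₁.1.aemeasurable hg₁i hg₂i hq)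
    exact (indicator_le_self _ _ x).trans (max_le le_self_add le_add_self)
  have hvm : MemNewtonian μ q U v := by
    refine memNewtonian_of_abs_le_add hq ?_ h₁.1 h₂.1 (fun x => abs_max_min_le _ _ c) hvg hvi
    exact h₁.1.1.sup (h₂.1.1.inf aemeasurable_const)
  have hv0 : MemNewtonianZero μ q U (fun x => u₁ x - v x) :=
    (h₁.1.sub hq hU hvm).memNewtonianZero_of_abs_le hq hU h₀ fun x _ => abs_sub_max_min_le _ _ c
  exact ⟨v, h₁.2 v hvm hv0,
    (isMinimalWeakUpperGradient_minGrad hq0 hU hvm.2.2).2.2 _ hvg hvi⟩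

/-- Swapping is not mere negation: `⊤ - ⊤` and `⊥ - ⊥` are `⊥` in either order. Such points form a
null set and are avoided by almost every curve. -/
theorem MemNewtonianZero.sub_comm (hq : 0 < q)
    (h₀ : MemNewtonianZero μ q U (fun x => u₁ x - u₂ x)) :
    MemNewtonianZero μ q U (fun x => u₂ x - u₁ x) := by
  obtain ⟨hm, hi, g, hg, hgi⟩ := h₀
  have hfin := MemNewtonian.ae_coe_toReal hq ⟨hm, hi, g, hg, hgi⟩
  have hneg : ∀ x, (∃ r : ℝ, (U.indicator fun x => u₁ x - u₂ x) x = r) →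
      (U.indicator fun x => u₂ x - u₁ x) x = -(U.indicator fun x => u₁ x - u₂ x) x := by
    rintro x ⟨r, hr⟩
    by_cases hx : x ∈ U
    · rw [indicator_of_mem hx] at hr ⊢
      rw [indicator_of_mem hx]
      obtain ⟨⟨s, hs⟩, t, ht⟩ := EReal.exists_coe_of_abs_sub_ne_top
        (x := u₁ x) (y := u₂ x) (by rw [hr]; exact (EReal.abs_coe_lt_top r).ne)
      rw [hs, ht, ← EReal.coe_sub, ← EReal.coe_sub, ← EReal.coe_neg, neg_sub]
    · simp [hx]
  have hae : (U.indicator fun x => u₂ x - u₁ x) =ᵐ[μ.restrict univ]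
      fun x => -(U.indicator fun x => u₁ x - u₂ x) x := by
    filter_upwards [hfin] with x hx
    exact hneg x ⟨_, hx⟩
  refine ⟨(measurable_neg.comp_aemeasurable hm).congr hae.symm, ?_, g, ?_, hgi⟩
  · refine lt_of_le_of_lt (lintegral_mono_ae ?_) hi
    filter_upwards [hae] with x hx
    rw [hx, EReal.abs_neg]
  · refine isWeakUpperGradient_of_absContAlong hq .univ hg.1 ?_
    filter_upwards [hg.eventually_absContAlong hq .univ hgi] with γ h hγ
    refine .of_eq (fun t ht => ?_) (h hγ).absCont.neg ?_
    · rw [hneg _ ⟨_, (h hγ).coe_toReal t ht⟩, (h hγ).coe_toReal t ht]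
      simp
    · filter_upwards [(h hγ).deriv_le] with t ht hmem
      rw [deriv.neg', enorm_neg]
      exact ht hmem

theorem energy_lt_top_of_isBounded (hμ : IsDoubling μ) (hp : 0 < p) (hpq : p < q) {β : ℝ}
    (ha : ∀ x, a x ≤ β) (hb : ∀ x, b x ≤ β) (hU : MeasurableSet U) (hUb : Bornology.IsBounded U)
    (hu : MemNewtonian μ q U u) : energy μ p q a b U u < ⊤ := by
  obtain ⟨hg, hgi, -⟩ := isMinimalWeakUpperGradient_minGrad (hp.trans hpq) hU hu.2.2
  have hUt : μ U < ⊤ := by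
    rcases U.eq_empty_or_nonempty with rfl | ⟨y, -⟩
    · simp
    obtain ⟨R, hR⟩ := hUb.subset_ball y
    obtain ⟨C, -, hC⟩ := hμ
    refine (measure_mono (hR.trans (ball_subset_ball (le_max_left R 1)))).trans_lt
      (hC y _ (by positivity)).2.2
  have hbound : ∀ (c : X → ℝ), (∀ x, c x ≤ β) → ∀ r : ℝ, 0 ≤ r → r ≤ q →
      ∫⁻ x in U, ENNReal.ofReal (c x) * minGrad μ q U u x ^ r ∂μ < ⊤ := by
    intro c hc r hr hrq
    refine (lintegral_mono fun x => mul_le_mul_left (ENNReal.ofReal_le_ofReal (hc x)) _).trans_lt ?_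
    rw [lintegral_const_mul _ (hg.1.pow_const r)]
    exact ENNReal.mul_lt_top ENNReal.ofReal_lt_top (setLIntegral_rpow_lt_top hr hrq hUt hgi)
  exact ENNReal.add_lt_top.2 ⟨hbound a ha p hp.le hpq.le, hbound b hb q (hp.trans hpq).le le_rfl⟩

/-! ### What minimality says about the gradients. -/

theorem IsMinimizer.minGrad_ae_eq (hp : 1 < p) (hq : 1 < q) (hU : MeasurableSet U)
    (ha : AEMeasurable a μ) (hb : AEMeasurable b μ) (hb0 : ∀ x, 0 < b x)
    (h₁ : IsMinimizer μ p q a b U u₁) (h₂ : IsMinimizer μ p q a b U u₂)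
    (h₀ : MemNewtonianZero μ q U (fun x => u₁ x - u₂ x)) (hfin : energy μ p q a b U u₁ < ⊤) :
    minGrad μ q U u₁ =ᵐ[μ.restrict U] minGrad μ q U u₂ := by
  have hq0 : 0 < q := by linarith
  obtain ⟨v, hle, hv⟩ := h₁.exists_midpoint hq.le hU h₂ h₀
  refine ae_eq_of_energy_midpoint_le hp hq ha.restrict.ennreal_ofReal hb.restrict.ennreal_ofReal
    (fun x => by simpa using hb0 x) (fun x => ENNReal.ofReal_ne_top)
    (h₁.minGrad_spec hq0 hU).1.1.aemeasurable (h₂.minGrad_spec hq0 hU).1.1.aemeasurable hv hfin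
    ?_ hle
  exact le_antisymm (h₁.2 u₂ h₂.1 h₀) (h₂.2 u₁ h₁.1 (h₀.sub_comm hq0))

theorem IsMinimizer.minGrad_ae_eq_zero_of_lt (hp : 1 < p) (hq : 1 < q) (hU : MeasurableSet U)
    (ha : AEMeasurable a μ) (hb : AEMeasurable b μ) (hb0 : ∀ x, 0 < b x)
    (h₁ : IsMinimizer μ p q a b U u₁) (h₂ : IsMinimizer μ p q a b U u₂)
    (h₀ : MemNewtonianZero μ q U (fun x => u₁ x - u₂ x)) (hfin : energy μ p q a b U u₁ < ⊤) :
    ∀ᵐ x ∂(μ.restrict U), u₁ x < u₂ x → minGrad μ q U u₁ x = 0 := by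
  have hq0 : 0 < q := by linarith
  have heq := h₁.minGrad_ae_eq hp hq hU ha hb hb0 h₂ h₀ hfin
  have hc : ∀ c : ℚ, ∀ᵐ x ∂(μ.restrict U),
      u₁ x < ((c : ℝ) : EReal) → ((c : ℝ) : EReal) < u₂ x → minGrad μ q U u₁ x = 0 := by
    intro c
    have hnull : NullMeasurableSet {x | u₁ x < ((c : ℝ) : EReal) ∧ ((c : ℝ) : EReal) < u₂ x}
        (μ.restrict U) :=
      (nullMeasurableSet_lt h₁.1.1 aemeasurable_const).inter
        (nullMeasurableSet_lt aemeasurable_const h₂.1.1)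
    -- The level set is only null measurable, whereas a weak upper gradient cut off along it must be
    -- measurable; a measurable subset of full measure replaces it.
    obtain ⟨S, hSsub, hS, hSae⟩ := hnull.exists_measurable_subset_ae_eq
    obtain ⟨v, hle, hv⟩ := h₁.exists_max_min hq.le hU h₂ h₀ c hS fun x hx => hSsub hx
    -- Equality of the two gradients collapses their maximum to that of `u₁`, so the competitor can
    -- be compared with `u₁` alone.
    have hv' : ∀ᵐ x ∂(μ.restrict U),
        minGrad μ q U v x ≤ Sᶜ.indicator (minGrad μ q U u₁) x := by
      filter_upwards [hv, heq] with x k1 k2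
      refine k1.trans (le_of_eq ?_)
      by_cases hx : x ∈ S
      · simp [hx]
      · simp [hx, ← k2]
    have := ae_eq_zero_of_energy_indicator_compl_le (by linarith) hq0 ha.restrict.ennreal_ofReal
      hb.restrict.ennreal_ofReal (fun x => by simpa using hb0 x)
      (h₁.minGrad_spec hq0 hU).1.1.aemeasurable hS hv' hfin hle
    filter_upwards [this, hSae.mem_iff] with x k1 k2 hx1 hx2
    exact k1 (k2.2 ⟨hx1, hx2⟩)
  filter_upwards [ae_all_iff.2 hc] with x hx hlt
  obtain ⟨c, hc1, hc2⟩ := EReal.exists_rat_btwn_of_lt hlt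
  exact hx c hc1 hc2

end Newtonian

/-! ### Uniqueness of minimizers. -/

theorem theorem3p2 {X : Type*} [MetricSpace X] [CompleteSpace X] [MeasurableSpace X]
    [BorelSpace X] (μ : Measure X) (hμ : Newtonian.IsDoubling μ)
    {p q : ℝ} (hp : 1 < p) (hpq : p < q) (hPI : Newtonian.SupportsPoincare μ p)
    {Ω : Set X} (hΩ : IsOpen Ω) (hΩne : Ω.Nonempty) (hΩc : 0 < μ Ωᶜ)
    {α β : ℝ} (hα : 0 < α) {a b : X → ℝ} (ha : AEMeasurable a μ) (hb : AEMeasurable b μ)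
    (ha' : ∀ x, α ≤ a x ∧ a x ≤ β) (hb' : ∀ x, α ≤ b x ∧ b x ≤ β)
    {u₁ u₂ : X → EReal}
    (h₁ : Newtonian.IsMinimizer μ p q a b Ω u₁) (h₂ : Newtonian.IsMinimizer μ p q a b Ω u₂)
    (h₀ : Newtonian.MemNewtonianZero μ q Ω (fun x => u₁ x - u₂ x))
    (hfin : Bornology.IsBounded Ω ∨ Newtonian.energy μ p q a b Ω u₁ < ⊤) :
    (∀ᵐ x ∂(μ.restrict Ω), Newtonian.minGrad μ q Ω u₁ x = Newtonian.minGrad μ q Ω u₂ x) ∧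
    (∀ᵐ x ∂(μ.restrict Ω), u₁ x = u₂ x) ∧
    Newtonian.capacity μ q {x ∈ Ω | u₁ x ≠ u₂ x} = 0 := by
  have hq : 1 < q := hp.trans hpq
  have hq0 : 0 < q := by linarith
  have hU : MeasurableSet Ω := hΩ.measurableSet
  have hb0 : ∀ x, 0 < b x := fun x => hα.trans_le (hb' x).1
  have hfin₁ : Newtonian.energy μ p q a b Ω u₁ < ⊤ := hfin.elim (fun hbd =>
    Newtonian.energy_lt_top_of_isBounded hμ (by linarith) hpq (fun x => (ha' x).2)
      (fun x => (hb' x).2) hU hbd h₁.1) id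
  have h₀' := h₀.sub_comm hq0
  have hfin₂ : Newtonian.energy μ p q a b Ω u₂ < ⊤ := (h₂.2 u₁ h₁.1 h₀').trans_lt hfin₁
  have hgrad := h₁.minGrad_ae_eq hp hq hU ha hb hb0 h₂ h₀ hfin₁
  have hlt := h₁.minGrad_ae_eq_zero_of_lt hp hq hU ha hb hb0 h₂ h₀ hfin₁
  have hgt := h₂.minGrad_ae_eq_zero_of_lt hp hq hU ha hb hb0 h₁ h₀' hfin₂
  have hvan : ∀ᵐ x ∂(μ.restrict Ω), u₁ x ≠ u₂ x →
      Newtonian.minGrad μ q Ω u₁ x = 0 ∧ Newtonian.minGrad μ q Ω u₂ x = 0 := by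
    filter_upwards [hgrad, hlt, hgt] with x k1 k2 k3 hne
    rcases lt_or_gt_of_ne hne with h | h
    · exact ⟨k2 h, k1 ▸ k2 h⟩
    · exact ⟨k1.trans (k3 h), k3 h⟩
  have hs₁ := h₁.minGrad_spec hq0 hU
  have hs₂ := h₂.minGrad_spec hq0 hU
  have hzero := Newtonian.isWeakUpperGradient_zero_of_ae_eq_zero hq0 hΩ hs₁.1 hs₁.2.1 hs₂.1 hs₂.2.1
    h₀ hvan
  have hae := Newtonian.ae_eq_zero_of_isWeakUpperGradient_zero hμ hp hpq hPI h₀ hzero hΩc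
    fun x hx => indicator_of_notMem hx _
  -- A zero difference in `EReal` forces both values to be finite, since `⊤ - ⊤` and `⊥ - ⊥` are
  -- `⊥`.
  have hsub : ∀ x ∈ Ω, (Ω.indicator fun x => u₁ x - u₂ x) x = 0 → u₁ x = u₂ x := by
    intro x hx h
    rw [indicator_of_mem hx] at h
    obtain ⟨⟨s, hs⟩, t, ht⟩ := EReal.exists_coe_of_abs_sub_ne_top
      (x := u₁ x) (y := u₂ x) (by rw [h]; simp)
    rw [hs, ht, ← EReal.coe_sub, EReal.coe_eq_zero, sub_eq_zero] at h
    rw [hs, ht, h]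
  refine ⟨hgrad, ?_, ?_⟩
  · rw [ae_restrict_iff' hU]
    filter_upwards [hae] with x hx hxΩ
    exact hsub x hxΩ hx
  · exact Newtonian.capacity_eq_zero_of_ae_eq_zero hq0 h₀ hae fun x hx h => hx.2 (hsub x hx.1 h)
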